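/- Let $s>\tfrac52$ and $\beta\in(0,\infty)$. Consider on $\mathbb R$ the 3-component Degasperis-Procesi system $$\begin{cases}\rho_t+(\rho uv)_x=0,\\ m_t+uvm_x+3vu_xm+\rho^2u=0,\\ n_t+uvn_x+3v_xun-\rho^2v=0,\\ m=u-u_{xx},\quad n=v-v_{xx}.\end{cases}\tag{1}$$ For $T\in(0,\infty]$, a solution of (1) on $[0,T)$ with initial data $w_0=(\rho_0,u_0,v_0)\in H^{s-1}\times H^s\times H^s$ is a triple $w=(\rho,u,v)\in C([0,T);H^{s-1}\times H^s\times H^s)$ with $w(0)=w_0$ that satisfies (1) in the sense of distributions on $\mathbb R$ at every time $t\in(0,T)$; elements of $H^{s-1}$ and $H^s$ are identified with their continuous representatives. (In particular, $T$ may be the lifespan of $w$.) Write $\|(f_1,\dots,f_7)\|_{L^\infty}=\max_i\|f_i\|_{L^\infty}$. For all $C_0,M\ge 0$ and $L\in\mathbb R$ there is a constant $C_1\ge0$, depending only on $s,\beta,C_0,M,L$, such that the following holds. Let $w$ be a solution of (1) on $[0,T)$, $T\in(0,\infty]$, with initial data $w_0$ satisfying $$\bigl\|(\rho_0,u_0,u_{0,x},u_{0,xx},v_0,v_{0,x},v_{0,xx})\,(\ln(e+\beta+|x|))^\beta\bigr\|_{L^\infty}\le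 C_0 .$$ Let $0\le T_0<T$ with $T_0\le L$ and $$\sup_{t\in[0,T_0]}\bigl(\|\rho(t)\|_{H^{s-1}}+\|u(t)\|_{H^s}+\|v(t)\|_{H^s}\bigr)\le M .$$ Then for every $t\in[0,T_0]$ $$\bigl\|(\rho,u,u_x,u_{xx},v,v_x,v_{xx})(t,\cdot)\,(\ln(e+\beta+|x|))^\beta\bigr\|_{L^\infty}\le C_1 .$$ (For every $T_0\in[0,T)$ such an $M$ exists by continuity, so the weighted norm is bounded uniformly on $[0,T_0]$ for every $T_0<T$. With $L=1$ and $T_0\le\min(1,T/2)$ the constant depends only on $s,\beta,C_0,M$.) -/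

import Mathlib

open MeasureTheory Set Filter Topology
open scoped ENNReal NNReal ContDiff FourierTransform SchwartzMap

noncomputable section

namespace ThreeDP

/-- The complexification of a real function on the line. -/
def toComplex (f : ℝ → ℝ) : ℝ → ℂ := fun x => (f x : ℂ)

/-- `f ∈ H^s(ℝ)`: the function `f` is square integrable and the tempered distribution that it
defines lies in the Bessel potential space of order `s` (only `s ≥ 0` is used). -/
def MemHs (s : ℝ) (f : ℝ → ℝ) : Prop :=
  ∃ hf : MemLp (toComplex f) 2 (volume : Measure ℝ),
    TemperedDistribution.MemSobolev s 2 ((hf.toLp (toComplex f) : Lp ℂ 2 (volume : Measure ℝ)) :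
      𝓢'(ℝ, ℂ))

open Classical in
/-- The norm `‖f‖_{H^s} = ‖(1 - ∂ₓ²)^{s/2} f‖_{L²} = ‖(1 + |2πξ|²)^{s/2} (𝓕 f)(ξ)‖_{L²}`, where
`(𝓕 f)(ξ) = ∫ exp(-2πixξ) f(x) dx` is the Fourier transform on `L²`; it is `∞` if `f ∉ L²`. -/
def hsNorm (s : ℝ) (f : ℝ → ℝ) : ℝ≥0∞ :=
  if hf : MemLp (toComplex f) 2 (volume : Measure ℝ) then
    eLpNorm (fun ξ : ℝ => ((1 + (2 * Real.pi * ξ) ^ 2) ^ (s / 2) : ℝ) •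
      (𝓕 (hf.toLp (toComplex f) : Lp ℂ 2 (volume : Measure ℝ)) : Lp ℂ 2 (volume : Measure ℝ)) ξ)
      2 volume
  else ∞

/-- The time interval `[0, T)`, where `T` may be `∞`. -/
def timeIco (T : EReal) : Set ℝ := {t | 0 ≤ t ∧ (t : EReal) < T}

/-- `f ∈ C([0, T); H^s)`. Each `f t` is the continuous representative of its class, which exists
for `s > 1/2`. -/
structure IsContinuousCurve (s : ℝ) (T : EReal) (f : ℝ → ℝ → ℝ) : Prop where
  mem : ∀ t ∈ timeIco T, MemHs s (f t)
  representative : ∀ t ∈ timeIco T, Continuous (f t)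
  tendsto : ∀ t ∈ timeIco T,
    Tendsto (fun t' => hsNorm s (fun x => f t' x - f t x)) (𝓝[timeIco T] t) (𝓝 0)

/-- The momentum `m = u - u_{xx}`. -/
def momentum (u : ℝ → ℝ) : ℝ → ℝ := fun x => u x - deriv (deriv u) x

/-- The pairing of the distribution `a b m_x + 3 b a_x m` with the test function `φ`, where `a`, `b`
are `C²` and `m` is continuous: `⟨a b m_x, φ⟩ = -∫ m (a b φ)_x dx`. -/
def transportPairing (a b m φ : ℝ → ℝ) : ℝ :=
  -(∫ x, m x * deriv (fun y => a y * b y * φ y) x) + ∫ x, 3 * b x * deriv a x * m x * φ x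

/-- `(ρ, u, v) ∈ C([0, T); H^{s-1} × H^s × H^s)` solves, with initial data `(ρ₀, u₀, v₀)`,
`ρ_t + (ρuv)_x = 0`, `m_t + u v m_x + 3 v u_x m + ρ² u = 0`,
`n_t + u v n_x + 3 v_x u n - ρ² v = 0`, `m = u - u_{xx}`, `n = v - v_{xx}`.
The equations hold in the space of distributions on the line at every time `t ∈ (0, T)`. -/
structure IsSolution (s : ℝ) (T : EReal) (ρ₀ u₀ v₀ : ℝ → ℝ) (ρ u v : ℝ → ℝ → ℝ) : Prop where
  regularity_rho : IsContinuousCurve (s - 1) T ρ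
  regularity_u : IsContinuousCurve s T u
  regularity_v : IsContinuousCurve s T v
  initial_rho : ρ 0 = ρ₀
  initial_u : u 0 = u₀
  initial_v : v 0 = v₀
  equation_rho : ∀ φ : ℝ → ℝ, ContDiff ℝ ∞ φ → HasCompactSupport φ →
    ∀ t : ℝ, 0 < t → (t : EReal) < T →
      HasDerivAt (fun t' => ∫ x, ρ t' x * φ x)
        (∫ x, ρ t x * u t x * v t x * deriv φ x) t
  equation_m : ∀ φ : ℝ → ℝ, ContDiff ℝ ∞ φ → HasCompactSupport φ →
    ∀ t : ℝ, 0 < t → (t : EReal) < T →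
      HasDerivAt (fun t' => ∫ x, momentum (u t') x * φ x)
        (-transportPairing (u t) (v t) (momentum (u t)) φ - ∫ x, (ρ t x) ^ 2 * u t x * φ x) t
  equation_n : ∀ φ : ℝ → ℝ, ContDiff ℝ ∞ φ → HasCompactSupport φ →
    ∀ t : ℝ, 0 < t → (t : EReal) < T →
      HasDerivAt (fun t' => ∫ x, momentum (v t') x * φ x)
        (-transportPairing (v t) (u t) (momentum (v t)) φ + ∫ x, (ρ t x) ^ 2 * v t x * φ x) t

/-- The weight `(ln (e + β + |x|))^β`. -/
def logWeight (β x : ℝ) : ℝ := (Real.log (Real.exp 1 + β + |x|)) ^ β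

/-- `‖(ρ, u, u_x, u_{xx}, v, v_x, v_{xx}) (ln (e + β + |x|))^β‖_{L^∞} ≤ C`. -/
def WeightedBound (β : ℝ) (C : ℝ≥0) (ρ u v : ℝ → ℝ) : Prop :=
  ∀ f ∈ ([ρ, u, deriv u, deriv (deriv u), v, deriv v, deriv (deriv v)] : List (ℝ → ℝ)),
    eLpNorm (fun x => f x * logWeight β x) ∞ volume ≤ (C : ℝ≥0∞)

end ThreeDP

end

/-! The densities `ρ`, `m`, `n` are all transported by the same velocity `uv`. Along a
characteristic `q' = uv(t, q)` they satisfy `ρ' = -ρ (uv)_x`, `m' = -3 v u_x m - ρ² u`, `n' = -3 u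
v_x n + ρ² v`. Since `s > 5/2`, the Sobolev embedding bounds `ρ`, `u`, `v` and the first two
derivatives of `u`, `v` by some `B` depending only on `s` and `M`. Hence `E = ρ² + m² + n²` obeys
`E' ≤ 7 B² E` on each characteristic, and Gronwall compares `E` at `(t, x)` with `E` at a single
initial point (`exists_density_le`).

That point lies within `B² L` of `x`, because `|uv| ≤ B²`. The weight is moderate, `w x ≤ D exp (|x
- y| / 2) w y` (`exists_logWeight_le`), so moving it to the foot of the characteristic costs only a
constant, and the decay of `E` persists (`density_mul_sq_weight_le`). The decay of `u`, `u_x`,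
`u_xx` follows from that of `m` by inverting the two first-order factors of `1 - ∂ₓ² = (1 - ∂ₓ)(1 +
∂ₓ)`. Their inverses have kernels decaying at rate `1`, faster than the growth rate `1/2` allowed
for the weight (`BoundedC2.weighted_bounds`).

The delicate point is the differential equation on characteristics: `m` is merely continuous and its
equation holds only in the sense of distributions. The equation is tested with a mollifier centred
at the moving point `q t`. The commutator with the transport term vanishes uniformly in time as the
width tends to zero (`abs_commutator_le`, `hasDerivAt_along_characteristic`). -/

noncomputable section

namespace ThreeDP

/-! ### Sobolev embedding on the Fourier side -/

/-- The Japanese bracket `1 + (2πξ)²` on the frequency side. -/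
def bracket (ξ : ℝ) : ℝ := 1 + (2 * Real.pi * ξ) ^ 2

lemma one_le_bracket (ξ : ℝ) : 1 ≤ bracket ξ := by
  unfold bracket; nlinarith [sq_nonneg (2 * Real.pi * ξ)]

lemma bracket_pos (ξ : ℝ) : 0 < bracket ξ := one_pos.trans_le (one_le_bracket ξ)

lemma continuous_bracket : Continuous bracket := by unfold bracket; fun_prop

lemma continuous_bracket_rpow (r : ℝ) : Continuous fun ξ => bracket ξ ^ r :=
  continuous_bracket.rpow_const fun ξ => Or.inl (bracket_pos ξ).ne'

/-- The bracket grows like `ξ²`, so the squared function decays like `|ξ| ^ (4 * r)`, with `4 * r <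
-1`. -/
lemma memLp_bracket_rpow {r : ℝ} (hr : r < -(1 / 4)) :
    MemLp (fun ξ => bracket ξ ^ r) 2 volume := by
  rw [memLp_two_iff_integrable_sq (continuous_bracket_rpow r).aestronglyMeasurable]
  have h : Integrable (fun x : ℝ => ((1 : ℝ) + ‖x‖ ^ 2) ^ (-(-4 * r) / 2)) volume :=
    integrable_rpow_neg_one_add_norm_sq (by simp; linarith)
  have h2 := h.comp_mul_left' (R := 2 * Real.pi) (by positivity)
  refine h2.congr (Eventually.of_forall fun ξ => ?_)
  have hb : (1 : ℝ) + ‖2 * Real.pi * ξ‖ ^ 2 = bracket ξ := by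
    rw [Real.norm_eq_abs, sq_abs]; rfl
  simp only [hb]
  rw [← Real.rpow_natCast, ← Real.rpow_mul (bracket_pos ξ).le]
  congr 1
  push_cast
  ring

/-- Cauchy-Schwarz after splitting off the factor `bracket ξ ^ ((k - σ) / 2)`, which is square
integrable because `k + 1 / 2 < σ`. -/
lemma exists_eLpNorm_one_le {σ k : ℝ} (h : k + 1 / 2 < σ) :
    ∃ C : ℝ≥0, ∀ F : ℝ → ℂ, AEStronglyMeasurable F volume →
      eLpNorm (fun ξ => bracket ξ ^ (k / 2) • F ξ) 1 volume ≤
        C * eLpNorm (fun ξ => bracket ξ ^ (σ / 2) • F ξ) 2 volume := by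
  have hL := memLp_bracket_rpow (r := (k - σ) / 2) (by linarith)
  refine ⟨(eLpNorm (fun ξ => bracket ξ ^ ((k - σ) / 2)) 2 volume).toNNReal, fun F hF => ?_⟩
  rw [ENNReal.coe_toNNReal hL.eLpNorm_ne_top]
  have hEq : (fun ξ => bracket ξ ^ (k / 2) • F ξ) =
      (fun ξ => bracket ξ ^ ((k - σ) / 2)) • fun ξ => bracket ξ ^ (σ / 2) • F ξ := by
    ext ξ
    simp only [Pi.smul_apply', smul_smul]
    rw [← Real.rpow_add (bracket_pos ξ)]
    congr 2
    ring
  rw [hEq]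
  exact eLpNorm_smul_le_mul_eLpNorm
    ((continuous_bracket_rpow _).aestronglyMeasurable.smul hF) hL.1

/-- Fourier inversion for a continuous square integrable function with integrable Fourier
transform. -/
lemma toComplex_eq_fourier_neg {f : ℝ → ℝ} (hc : Continuous f)
    (hf : MemLp (toComplex f) 2 (volume : Measure ℝ))
    (hF : Integrable (𝓕 (hf.toLp (toComplex f) : Lp ℂ 2 (volume : Measure ℝ)) :
      Lp ℂ 2 (volume : Measure ℝ)) volume) (x : ℝ) :
    (f x : ℂ) = 𝓕 (((𝓕 (hf.toLp (toComplex f) : Lp ℂ 2 (volume : Measure ℝ)) :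
      Lp ℂ 2 (volume : Measure ℝ)) : ℝ → ℂ)) (-x) := by
  set U : Lp ℂ 2 (volume : Measure ℝ) := hf.toLp (toComplex f)
  set F : Lp ℂ 2 (volume : Measure ℝ) := 𝓕 U
  have hcF : Continuous (𝓕 (F : ℝ → ℂ)) :=
    VectorFourier.fourierIntegral_continuous Real.continuous_fourierChar
      (by exact continuous_inner) hF
  have hcf : Continuous (toComplex f) := Complex.continuous_ofReal.comp hc
  -- Both sides are continuous, so equality almost everywhere suffices, and this is tested against
  -- smooth compactly supported `g`. The `L²` transform is accessible through its tempered
  -- distribution; the transform is then moved between the factors by Fubini, which needs `F`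
  -- integrable.
  have key : ∀ᵐ y ∂(volume : Measure ℝ), toComplex f y = 𝓕 (F : ℝ → ℂ) (-y) := by
    refine ae_eq_of_integral_contDiff_smul_eq hcf.locallyIntegrable
      (hcF.comp continuous_neg).locallyIntegrable fun g hg hgs => ?_
    have hg₁ : HasCompactSupport (Complex.ofRealCLM ∘ g) := hgs.comp_left rfl
    have hg₂ : ContDiff ℝ ∞ (Complex.ofRealCLM ∘ g) := by fun_prop
    let φ : 𝓢(ℝ, ℂ) := hg₁.toSchwartzMap hg₂
    have hφ : ∀ y, φ y = (g y : ℂ) := fun y => rfl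
    have hinv : 𝓕⁻ (F : 𝓢'(ℝ, ℂ)) = (U : 𝓢'(ℝ, ℂ)) := by
      rw [Lp.fourierInv_toTemperedDistribution_eq]
      simp [F]
    have h1 : (U : 𝓢'(ℝ, ℂ)) φ = ∫ y, g y • toComplex f y := by
      rw [Lp.toTemperedDistribution_apply]
      refine integral_congr_ae ?_
      filter_upwards [hf.coeFn_toLp] with y hy
      rw [hy, hφ]; simp
    have h2 : (U : 𝓢'(ℝ, ℂ)) φ = ∫ y, (𝓕⁻ φ) y • (F : ℝ → ℂ) y := by
      rw [← hinv, TemperedDistribution.fourierInv_apply, Lp.toTemperedDistribution_apply]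
    have h3 : ∫ y, (𝓕⁻ φ) y • (F : ℝ → ℂ) y = ∫ y, (𝓕 φ) y • (F : ℝ → ℂ) (-y) := by
      rw [← integral_neg_eq_self]
      refine integral_congr_ae (Eventually.of_forall fun y => ?_)
      simp only
      rw [SchwartzMap.fourierInv_coe, Real.fourierInv_eq_fourier_neg, neg_neg,
        SchwartzMap.fourier_coe]
    have h4 : ∫ y, (𝓕 φ) y • (F : ℝ → ℂ) (-y) =
        ∫ y, φ y • 𝓕 (fun z => (F : ℝ → ℂ) (-z)) y := by
      rw [SchwartzMap.fourier_coe]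
      have := VectorFourier.integral_fourierIntegral_smul_eq_flip (L := innerₗ ℝ)
        (e := Real.fourierChar) (μ := volume) (ν := volume)
        Real.continuous_fourierChar continuous_inner φ.integrable hF.comp_neg
      rw [flip_innerₗ] at this
      exact this
    have h5 : 𝓕 (fun z => (F : ℝ → ℂ) (-z)) = fun y => 𝓕 (F : ℝ → ℂ) (-y) := by
      ext y
      rw [← Real.fourierInv_eq_fourier_neg, Real.fourierInv_eq_fourier_comp_neg]
    rw [← h1, h2, h3, h4, h5]
    refine integral_congr_ae (Eventually.of_forall fun y => ?_)
    simp [hφ]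
  exact congrFun (Continuous.ae_eq_iff_eq volume hcf (hcF.comp continuous_neg) |>.1 key) x

/-- `f` is of class `C²` and `f`, `f'`, `f''` are bounded by `B`. -/
structure BoundedC2 (B : ℝ) (f : ℝ → ℝ) : Prop where
  differentiable : Differentiable ℝ f
  differentiable_deriv : Differentiable ℝ (deriv f)
  continuous_deriv2 : Continuous (deriv (deriv f))
  abs_le : ∀ x, |f x| ≤ B
  abs_deriv_le : ∀ x, |deriv f x| ≤ B
  abs_deriv2_le : ∀ x, |deriv (deriv f) x| ≤ B

lemma memLp_of_hsNorm_lt_top {s : ℝ} {f : ℝ → ℝ} (h : hsNorm s f < ⊤) :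
    MemLp (toComplex f) 2 (volume : Measure ℝ) := by
  by_contra hf
  rw [hsNorm, dif_neg hf] at h
  exact lt_irrefl _ h

/-- The Fourier transform of the complexification of a square integrable function. -/
def spectrum2 {f : ℝ → ℝ} (hf : MemLp (toComplex f) 2 (volume : Measure ℝ)) : ℝ → ℂ :=
  (𝓕 (hf.toLp (toComplex f) : Lp ℂ 2 (volume : Measure ℝ)) : Lp ℂ 2 (volume : Measure ℝ))

lemma aestronglyMeasurable_spectrum2 {f : ℝ → ℝ}
    (hf : MemLp (toComplex f) 2 (volume : Measure ℝ)) :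
    AEStronglyMeasurable (spectrum2 hf) volume :=
  Lp.aestronglyMeasurable _

lemma hsNorm_eq {s : ℝ} {f : ℝ → ℝ} (hf : MemLp (toComplex f) 2 (volume : Measure ℝ)) :
    hsNorm s f = eLpNorm (fun ξ => bracket ξ ^ (s / 2) • spectrum2 hf ξ) 2 volume := by
  rw [hsNorm, dif_pos hf]; rfl

lemma exists_spectrum_bound {σ k : ℝ} (h : k + 1 / 2 < σ) :
    ∃ C : ℝ, 0 ≤ C ∧ ∀ (f : ℝ → ℝ) (B : ℝ≥0), hsNorm σ f ≤ B →
      ∃ hf : MemLp (toComplex f) 2 (volume : Measure ℝ),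
        Integrable (fun ξ => bracket ξ ^ (k / 2) • spectrum2 hf ξ) volume ∧
        ∫ ξ, ‖bracket ξ ^ (k / 2) • spectrum2 hf ξ‖ ≤ C * B := by
  obtain ⟨C, hC⟩ := exists_eLpNorm_one_le h
  refine ⟨C, C.2, fun f B hB => ?_⟩
  have hf := memLp_of_hsNorm_lt_top (hB.trans_lt ENNReal.coe_lt_top)
  have hm := aestronglyMeasurable_spectrum2 hf
  have h1 := hC _ hm
  rw [← hsNorm_eq hf] at h1
  have h2 : eLpNorm (fun ξ => bracket ξ ^ (k / 2) • spectrum2 hf ξ) 1 volume ≤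
      ((C * B : ℝ≥0) : ℝ≥0∞) := by
    refine h1.trans ?_
    push_cast
    gcongr
  have hm' : AEStronglyMeasurable (fun ξ => bracket ξ ^ (k / 2) • spectrum2 hf ξ) volume :=
    (continuous_bracket_rpow _).aestronglyMeasurable.smul hm
  have hi : Integrable (fun ξ => bracket ξ ^ (k / 2) • spectrum2 hf ξ) volume :=
    memLp_one_iff_integrable.1 ⟨hm', h2.trans_lt ENNReal.coe_lt_top⟩
  refine ⟨hf, hi, ?_⟩
  rw [integral_norm_eq_lintegral_enorm hm', ← eLpNorm_one_eq_lintegral_enorm]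
  exact ENNReal.toReal_mono ENNReal.coe_ne_top h2

lemma norm_fourier_le_integral_norm (F : ℝ → ℂ) (x : ℝ) : ‖𝓕 F x‖ ≤ ∫ ξ, ‖F ξ‖ :=
  VectorFourier.norm_fourierIntegral_le_integral_norm _ _ _ _ _

/-- Sobolev embedding `H^σ ⊂ L^∞` for `σ > 1/2`. -/
lemma exists_sobolev_bound {σ : ℝ} (h : 1 / 2 < σ) :
    ∃ C : ℝ, 0 ≤ C ∧ ∀ (f : ℝ → ℝ) (B : ℝ≥0), Continuous f → hsNorm σ f ≤ B →
      ∀ x, |f x| ≤ C * B := by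
  obtain ⟨C, hC0, hC⟩ := exists_spectrum_bound (σ := σ) (k := 0) (by linarith)
  refine ⟨C, hC0, fun f B hc hB x => ?_⟩
  obtain ⟨hf, hi, hle⟩ := hC f B hB
  simp only [zero_div, Real.rpow_zero, one_smul] at hi hle
  rw [← Real.norm_eq_abs, ← Complex.norm_real, toComplex_eq_fourier_neg hc hf hi x]
  exact (norm_fourier_le_integral_norm _ _).trans hle

/-- Differentiating the inversion formula multiplies the spectrum by powers of `2πξ`. Up to order
two these are dominated by the bracket, whose product with the spectrum is integrable as `σ > 2 + 1
/ 2`; one constant serves all three bounds. -/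
lemma exists_sobolev_bound_C2 {σ : ℝ} (h : 5 / 2 < σ) :
    ∃ C : ℝ, 0 ≤ C ∧ ∀ (f : ℝ → ℝ) (B : ℝ≥0), Continuous f → hsNorm σ f ≤ B →
      BoundedC2 (C * B) f := by
  obtain ⟨C, hC0, hC⟩ := exists_spectrum_bound (σ := σ) (k := 2) (by linarith)
  refine ⟨C, hC0, fun f B hc hB => ?_⟩
  obtain ⟨hf, hi, hle⟩ := hC f B hB
  norm_num only [div_self, Real.rpow_one] at hi hle
  set G : ℝ → ℂ := spectrum2 hf with hG
  have hm : AEStronglyMeasurable G volume := aestronglyMeasurable_spectrum2 hf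
  -- The spectra of the successive derivatives of `𝓕 G`. Since `f` is `𝓕 G` at `-x`, each derivative
  -- of `f` brings an extra sign.
  let G1 : ℝ → ℂ := fun x => (-2 * Real.pi * Complex.I * x) • G x
  let G2 : ℝ → ℂ := fun x => (-2 * Real.pi * Complex.I * x) • G1 x
  have hcc : Continuous fun x : ℝ => (-2 * Real.pi * Complex.I * x : ℂ) := by fun_prop
  have hm1 : AEStronglyMeasurable G1 volume :=
    hcc.aestronglyMeasurable.smul hm
  have hm2 : AEStronglyMeasurable G2 volume :=
    hcc.aestronglyMeasurable.smul hm1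
  have hcoef : ∀ x : ℝ, ‖(-2 * Real.pi * Complex.I * x : ℂ)‖ = |2 * Real.pi * x| := fun x => by
    simp [abs_mul]
  have hb0 : ∀ x, ‖G x‖ ≤ ‖bracket x • G x‖ := fun x => by
    rw [norm_smul, Real.norm_of_nonneg (bracket_pos x).le]
    exact le_mul_of_one_le_left (norm_nonneg _) (one_le_bracket x)
  have hb1 : ∀ x, ‖G1 x‖ ≤ ‖bracket x • G x‖ := fun x => by
    simp only [G1]
    rw [norm_smul, norm_smul, Real.norm_of_nonneg (bracket_pos x).le, hcoef]
    refine mul_le_mul_of_nonneg_right ?_ (norm_nonneg _)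
    rw [bracket, ← sq_abs (2 * Real.pi * x)]
    nlinarith [sq_nonneg (|2 * Real.pi * x| - 1), abs_nonneg (2 * Real.pi * x)]
  have hb2 : ∀ x, ‖G2 x‖ ≤ ‖bracket x • G x‖ := fun x => by
    simp only [G2, G1]
    rw [norm_smul, norm_smul, norm_smul, Real.norm_of_nonneg (bracket_pos x).le, hcoef,
      ← mul_assoc]
    refine mul_le_mul_of_nonneg_right ?_ (norm_nonneg _)
    rw [bracket, ← sq_abs (2 * Real.pi * x)]
    nlinarith
  have hi0 : Integrable G volume := hi.mono hm (Eventually.of_forall hb0)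
  have hi1 : Integrable G1 volume := hi.mono hm1 (Eventually.of_forall hb1)
  have hi2 : Integrable G2 volume := hi.mono hm2 (Eventually.of_forall hb2)
  have hx0 : Integrable (fun x : ℝ => x • G x) volume := by
    refine hi1.mono (continuous_id.aestronglyMeasurable.smul hm) (Eventually.of_forall fun x => ?_)
    simp only [G1]
    rw [norm_smul, norm_smul, hcoef, abs_mul, Real.norm_eq_abs]
    refine mul_le_mul_of_nonneg_right ?_ (norm_nonneg _)
    refine le_mul_of_one_le_left (abs_nonneg _) ?_
    rw [abs_of_pos (by positivity : (0 : ℝ) < 2 * Real.pi)]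
    nlinarith [Real.pi_gt_three]
  have hx1 : Integrable (fun x : ℝ => x • G1 x) volume := by
    refine hi2.mono (continuous_id.aestronglyMeasurable.smul hm1) (Eventually.of_forall fun x => ?_)
    have hG2 : ‖G2 x‖ = |2 * Real.pi * x| * ‖G1 x‖ := by rw [← hcoef x]; exact norm_smul _ _
    rw [hG2, norm_smul, abs_mul, Real.norm_eq_abs]
    refine mul_le_mul_of_nonneg_right ?_ (norm_nonneg (G1 x))
    refine le_mul_of_one_le_left (abs_nonneg _) ?_
    rw [abs_of_pos (by positivity : (0 : ℝ) < 2 * Real.pi)]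
    nlinarith [Real.pi_gt_three]
  have hre : ∀ (H H' : ℝ → ℂ), (∀ w, HasDerivAt H (H' w) w) → ∀ x : ℝ,
      HasDerivAt (fun x => (H (-x)).re) (-(H' (-x))).re x := fun H H' hH x => by
    have h1 : HasDerivAt (fun x => H (-x)) (-(H' (-x))) x := by
      have := HasDerivAt.scomp (g₁ := H) x (hH (-x)) (hasDerivAt_neg x)
      rw [neg_one_smul] at this
      exact this
    exact Complex.reCLM.hasFDerivAt.comp_hasDerivAt x h1
  have hf0 : f = fun x => (𝓕 G (-x)).re := by
    ext x
    rw [← Complex.ofReal_re (f x), toComplex_eq_fourier_neg hc hf hi0 x]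
    rfl
  have hd0 : ∀ x, HasDerivAt f (-(𝓕 G1 (-x)).re) x := fun x => by
    rw [hf0, ← Complex.neg_re]; exact hre _ _ (Real.hasDerivAt_fourier hi0 hx0) x
  have hf1 : deriv f = fun x => -(𝓕 G1 (-x)).re := funext fun x => (hd0 x).deriv
  have hd1 : ∀ x, HasDerivAt (deriv f) (𝓕 G2 (-x)).re x := fun x => by
    rw [hf1]
    have := (hre _ _ (Real.hasDerivAt_fourier hi1 hx1) x).fun_neg
    rw [Complex.neg_re, neg_neg] at this
    exact this
  have hf2 : deriv (deriv f) = fun x => (𝓕 G2 (-x)).re := funext fun x => (hd1 x).deriv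
  have hcG2 : Continuous (𝓕 G2) :=
    VectorFourier.fourierIntegral_continuous Real.continuous_fourierChar
      (by exact continuous_inner) hi2
  have hbd : ∀ (H : ℝ → ℂ), Integrable H volume → (∀ x, ‖H x‖ ≤ ‖bracket x • G x‖) →
      ∀ x, |(𝓕 H (-x)).re| ≤ C * B := fun H hH hHb x =>
    (Complex.abs_re_le_norm _).trans <| (norm_fourier_le_integral_norm _ _).trans <|
      (integral_mono hH.norm hi.norm hHb).trans hle
  refine ⟨fun x => (hd0 x).differentiableAt, fun x => (hd1 x).differentiableAt, ?_, ?_, ?_, ?_⟩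
  · rw [hf2]; fun_prop
  · rw [hf0]; exact hbd G hi0 hb0
  · rw [hf1]; simpa only [abs_neg] using hbd G1 hi1 hb1
  · rw [hf2]; exact hbd G2 hi2 hb2

/-! ### Mollifiers and distributional transport equations -/

lemma abs_integral_le_of_concentrated {h : ℝ → ℝ} {K ε q : ℝ} (hε : 0 < ε)
    (hK : ∀ x, |x - q| ≤ ε → |h x| ≤ K) (h0 : ∀ x, ε < |x - q| → h x = 0) :
    |∫ x, h x| ≤ K * (2 * ε) := by
  have h1 : ∫ x, h x = ∫ x in Metric.closedBall q ε, h x := by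
    rw [setIntegral_eq_integral_of_forall_compl_eq_zero]
    intro x hx
    rw [Metric.mem_closedBall, Real.dist_eq, not_le] at hx
    exact h0 x hx
  have h2 := norm_setIntegral_le_of_norm_le_const (μ := volume) (s := Metric.closedBall q ε)
    (f := h) (C := K) (by rw [Real.volume_closedBall]; exact ENNReal.ofReal_lt_top)
    (fun x hx => by
      rw [Metric.mem_closedBall, Real.dist_eq] at hx
      exact hK x hx)
  rw [h1, ← Real.norm_eq_abs]
  refine h2.trans_eq ?_
  rw [Measure.real, Real.volume_closedBall, ENNReal.toReal_ofReal (by positivity)]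

/-- `φ` is a smooth bump of width `ε` and unit mass whose derivatives are controlled by `K`. -/
structure IsMollifier (K ε : ℝ) (φ : ℝ → ℝ) : Prop where
  contDiff : ContDiff ℝ ∞ φ
  hasCompactSupport : HasCompactSupport φ
  eq_zero : ∀ x, ε < |x| → φ x = 0
  deriv_eq_zero : ∀ x, ε < |x| → deriv φ x = 0
  integral_eq : ∫ x, φ x = 1
  abs_le : ∀ x, |φ x| ≤ K / ε
  abs_deriv_le : ∀ x, |deriv φ x| ≤ K / ε ^ 2

/-- Rescaling of one fixed bump. That `K` does not depend on `ε` is what lets the later error bounds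
tend to zero with the oscillation. -/
lemma exists_isMollifier : ∃ K : ℝ, 0 ≤ K ∧ ∀ ε : ℝ, 0 < ε → ∃ φ, IsMollifier K ε φ := by
  let bmp : ContDiffBump (0 : ℝ) := ⟨1 / 2, 1, by norm_num, by norm_num⟩
  let η : ℝ → ℝ := bmp.normed volume
  have hη : ContDiff ℝ ∞ η := bmp.contDiff_normed
  have hηc : HasCompactSupport η := bmp.hasCompactSupport_normed
  have hη0 : ∀ x, 1 < |x| → η x = 0 := fun x hx => by
    by_contra hne
    have : x ∈ Function.support η := hne
    rw [bmp.support_normed_eq, Metric.mem_ball, dist_zero_right, Real.norm_eq_abs] at this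
    exact lt_asymm hx this
  obtain ⟨K1, hK1⟩ := hηc.exists_bound_of_continuous hη.continuous
  obtain ⟨K2, hK2⟩ := hηc.deriv.exists_bound_of_continuous (hη.continuous_deriv (by simp))
  have hK1n : 0 ≤ K1 := (norm_nonneg _).trans (hK1 0)
  refine ⟨max K1 K2, hK1n.trans (le_max_left _ _), fun ε hε => ?_⟩
  have hφ : ContDiff ℝ ∞ fun x => ε⁻¹ * η (ε⁻¹ * x) := by fun_prop
  have hz : ∀ x, ε < |x| → ε⁻¹ * η (ε⁻¹ * x) = 0 := fun x hx => by
    rw [hη0, mul_zero]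
    rw [abs_mul, abs_of_pos (inv_pos.2 hε), ← div_eq_inv_mul, lt_div_iff₀ hε, one_mul]
    exact hx
  refine ⟨fun x => ε⁻¹ * η (ε⁻¹ * x), hφ, ?_, hz, fun x hx => ?_, ?_, fun x => ?_, fun x => ?_⟩
  · refine HasCompactSupport.of_support_subset_isCompact (isCompact_Icc (a := -ε) (b := ε))
      fun x hx => ?_
    by_contra hne
    refine hx (hz x ?_)
    by_contra hle
    exact hne (abs_le.1 (not_lt.1 hle))
  · have : (fun x => ε⁻¹ * η (ε⁻¹ * x)) =ᶠ[𝓝 x] fun _ => 0 := by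
      filter_upwards [(isOpen_lt continuous_const continuous_abs).mem_nhds hx] with y hy
      exact hz y hy
    rw [this.deriv_eq, deriv_const]
  · rw [integral_const_mul, Measure.integral_comp_mul_left, inv_inv, abs_of_pos hε,
      bmp.integral_normed, smul_eq_mul, mul_one, inv_mul_cancel₀ hε.ne']
  · rw [abs_mul, abs_of_pos (inv_pos.2 hε), div_eq_inv_mul]
    gcongr
    exact (hK1 _).trans (le_max_left _ _)
  · have hd : deriv (fun x => ε⁻¹ * η (ε⁻¹ * x)) x = ε⁻¹ * (ε⁻¹ * deriv η (ε⁻¹ * x)) := by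
      rw [deriv_const_mul_field, deriv_comp_mul_left, smul_eq_mul]
    rw [hd, abs_mul, abs_mul, abs_of_pos (inv_pos.2 hε), div_eq_inv_mul, ← mul_assoc,
      ← mul_inv, ← sq]
    gcongr
    exact (hK2 _).trans (le_max_right _ _)

/-- Differentiation of the pairing of a time dependent function with a moving test function. -/
lemma hasDerivAt_integral_moving {f : ℝ → ℝ → ℝ} {φ : ℝ → ℝ} {q : ℝ → ℝ} {t c D A : ℝ}
    (hφ : ContDiff ℝ ∞ φ) (hφc : HasCompactSupport φ)
    (hfc : ∀ᶠ t' in 𝓝 t, Continuous (f t')) (hfA : ∀ᶠ t' in 𝓝 t, ∀ x, |f t' x| ≤ A)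
    (hft : ∀ x, Tendsto (fun t' => f t' x) (𝓝 t) (𝓝 (f t x)))
    (hq : HasDerivAt q c t) (hD : HasDerivAt (fun t' => ∫ x, f t' x * φ (x - q t)) D t) :
    HasDerivAt (fun t' => ∫ x, f t' x * φ (x - q t'))
      (D - c * ∫ x, f t x * deriv φ (x - q t)) t := by
  have hcs : ∀ a, HasCompactSupport fun x => φ (x - a) := fun a =>
    hφc.comp_homeomorph (Homeomorph.subRight a)
  have hcont : ∀ a, Continuous fun x => φ (x - a) := fun a =>
    hφ.continuous.comp (continuous_id.sub continuous_const)
  have hint : ∀ g : ℝ → ℝ, Continuous g → ∀ a, Integrable (fun x => g x * φ (x - a)) volume :=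
    fun g hg a => (hg.mul (hcont a)).integrable_of_hasCompactSupport (hcs a).mul_left
  obtain ⟨Kφ, hKφ⟩ := ContDiff.lipschitzWith_of_hasCompactSupport hφc hφ (by simp)
  obtain ⟨R, hR⟩ := hφc.isCompact.isBounded.subset_closedBall 0
  have hφ0 : ∀ x, R < |x| → φ x = 0 := fun x hx => by
    by_contra hne
    have := hR (subset_tsupport φ hne)
    rw [Metric.mem_closedBall, dist_zero_right, Real.norm_eq_abs] at this
    exact absurd this (not_le.2 hx)
  have hqK : ∀ᶠ t' in 𝓝 t, |q t' - q t| ≤ (|c| + 1) * |t' - t| := by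
    have h1 := hq.isLittleO.bound (c := 1) one_pos
    filter_upwards [h1] with t' ht'
    have h2 : ‖q t' - q t - (t' - t) • c‖ ≤ 1 * ‖t' - t‖ := ht'
    simp only [Real.norm_eq_abs, smul_eq_mul] at h2
    calc |q t' - q t| = |(q t' - q t - (t' - t) * c) + (t' - t) * c| := by ring_nf
      _ ≤ _ := abs_add_le _ _
      _ ≤ 1 * |t' - t| + |t' - t| * |c| := by rw [abs_mul]; gcongr
      _ = _ := by ring
  have hq1 : ∀ᶠ t' in 𝓝 t, |q t' - q t| ≤ 1 := by
    have := hq.continuousAt.eventually (Metric.closedBall_mem_nhds (q t) one_pos)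
    simpa [Metric.mem_closedBall, Real.dist_eq] using this
  -- The moving test function is split as its value frozen at time `t`, handled by `hD`, plus an
  -- increment vanishing at `t' = t`. Because of this vanishing, `f` need only be continuous in time
  -- in this second term.
  have hG : HasDerivAt (fun t' => ∫ x, f t' x * (φ (x - q t') - φ (x - q t)))
      (∫ x, f t x * (-(c * deriv φ (x - q t)))) t := by
    rw [hasDerivAt_iff_tendsto_slope]
    have hs : slope (fun t' => ∫ x, f t' x * (φ (x - q t') - φ (x - q t))) t =
        fun t' => ∫ x, f t' x * slope (fun τ => φ (x - q τ)) t t' := by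
      ext t'
      simp only [slope_def_field, sub_self, mul_zero, integral_zero, sub_zero]
      rw [← integral_div]
      congr 1; ext x; ring
    rw [hs]
    refine tendsto_integral_filter_of_dominated_convergence
      -- For `t'` near `t` the path moves by at most `1`, so all the translated supports lie in the
      -- ball of radius `R + 1`; there the difference quotient is at most `Kφ * (|c| + 1)`.
      ((Metric.closedBall (q t) (R + 1)).indicator fun _ => A * (Kφ * (|c| + 1))) ?_ ?_ ?_ ?_
    · filter_upwards [hfc.filter_mono nhdsWithin_le_nhds] with t' hc'
      simp only [slope_def_field]
      exact (hc'.mul (((hcont _).sub (hcont _)).div_const _)).aestronglyMeasurable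
    · filter_upwards [hfA.filter_mono nhdsWithin_le_nhds, hqK.filter_mono nhdsWithin_le_nhds,
        hq1.filter_mono nhdsWithin_le_nhds, self_mem_nhdsWithin] with t' hA hK h1 hne
      refine Eventually.of_forall fun x => ?_
      have hne' : 0 < |t' - t| := abs_pos.2 (sub_ne_zero.2 hne)
      have hA0 : 0 ≤ A := (abs_nonneg _).trans (hA 0)
      by_cases hx : x ∈ Metric.closedBall (q t) (R + 1)
      · rw [indicator_of_mem hx, norm_mul, slope_def_field, norm_div]
        simp only [Real.norm_eq_abs]
        have h2 : |φ (x - q t') - φ (x - q t)| ≤ Kφ * ((|c| + 1) * |t' - t|) := by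
          have := hKφ.dist_le_mul (x - q t') (x - q t)
          rw [Real.dist_eq, Real.dist_eq] at this
          refine this.trans ?_
          gcongr
          calc |x - q t' - (x - q t)| = |q t' - q t| := by rw [← abs_neg]; ring_nf
            _ ≤ _ := hK
        gcongr
        · exact hA x
        · rw [div_le_iff₀ hne']; linarith
      · rw [indicator_of_notMem hx]
        rw [Metric.mem_closedBall, Real.dist_eq, not_le] at hx
        have e1 : φ (x - q t) = 0 := hφ0 _ (by linarith)
        have e2 : φ (x - q t') = 0 := hφ0 _ (by
          have := abs_sub_abs_le_abs_sub (x - q t) (x - q t')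
          have h3 : |x - q t - (x - q t')| = |q t' - q t| := by ring_nf
          linarith)
        simp [slope_def_field, e1, e2]
    · rw [integrable_indicator_iff measurableSet_closedBall]
      exact integrableOn_const measure_closedBall_lt_top.ne
    · refine Eventually.of_forall fun x => ?_
      refine ((hft x).mono_left nhdsWithin_le_nhds).mul ?_
      rw [← hasDerivAt_iff_tendsto_slope]
      have h1 : HasDerivAt φ (deriv φ (x - q t)) (x - q t) :=
        (hφ.differentiable (by simp) _).hasDerivAt
      have h2 := h1.comp t (hq.const_sub x)
      convert! h2 using 1
      ring
  have hsum := hD.add hG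
  have e1 : D + ∫ x, f t x * (-(c * deriv φ (x - q t))) =
      D - c * ∫ x, f t x * deriv φ (x - q t) := by
    rw [← integral_const_mul, sub_eq_add_neg, ← integral_neg]
    congr 2; ext x; ring
  rw [e1] at hsum
  refine hsum.congr_of_eventuallyEq ?_
  filter_upwards [hfc] with t' hc'
  simp only [Pi.add_apply]
  rw [← integral_add (hint _ hc' _)]
  · congr 1; ext x; ring
  · simp only [mul_sub]
    exact (hint _ hc' _).sub (hint _ hc' _)

/-- A jointly continuous function oscillates uniformly little near a continuous path. -/
lemma exists_uniform_oscillation {h : ℝ → ℝ → ℝ} {q : ℝ → ℝ} {T₀ : ℝ}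
    (hh : ContinuousOn (fun p : ℝ × ℝ => h p.1 p.2) (Icc 0 T₀ ×ˢ univ))
    (hq : ContinuousOn q (Icc 0 T₀)) {δ : ℝ} (hδ : 0 < δ) :
    ∃ ε > 0, ∀ t ∈ Icc 0 T₀, ∀ x, |x - q t| ≤ ε → |h t x - h t (q t)| ≤ δ := by
  obtain ⟨R, hR⟩ := isCompact_Icc.exists_bound_of_continuousOn hq
  have hK : IsCompact (Icc 0 T₀ ×ˢ Icc (-(R + 1)) (R + 1)) := isCompact_Icc.prod isCompact_Icc
  have hu := hK.uniformContinuousOn_of_continuous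
    (hh.mono (prod_mono_right (subset_univ _)))
  rw [Metric.uniformContinuousOn_iff] at hu
  obtain ⟨ε, hε, hu⟩ := hu δ hδ
  refine ⟨min (ε / 2) 1, by positivity, fun t ht x hx => ?_⟩
  have hqt : |q t| ≤ R := hR t ht
  have hx1 : |x - q t| ≤ 1 := hx.trans (min_le_right _ _)
  have hx2 : |x| ≤ R + 1 := by
    have := abs_sub_abs_le_abs_sub x (q t)
    linarith
  have := hu (t, x) ⟨ht, abs_le.1 hx2⟩ (t, q t) ⟨ht, abs_le.1 (by linarith)⟩ (by
    rw [Prod.dist_eq, dist_self, max_eq_right dist_nonneg, Real.dist_eq]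
    have := hx.trans (min_le_left _ _)
    linarith)
  exact this.le

lemma abs_integral_mollifier_sub_le {h φ : ℝ → ℝ} {K ε q δ : ℝ} (hε : 0 < ε)
    (hφ : IsMollifier K ε φ) (hh : Continuous h) (hosc : ∀ x, |x - q| ≤ ε → |h x - h q| ≤ δ) :
    |(∫ x, h x * φ (x - q)) - h q| ≤ 2 * K * δ := by
  have hc : Continuous fun x => φ (x - q) := hφ.contDiff.continuous.comp (by fun_prop)
  have hs : HasCompactSupport fun x => φ (x - q) :=
    hφ.hasCompactSupport.comp_homeomorph (Homeomorph.subRight q)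
  have e : (∫ x, h x * φ (x - q)) - h q = ∫ x, (h x - h q) * φ (x - q) := by
    have i1 : Integrable (fun x => h x * φ (x - q)) volume :=
      (hh.mul hc).integrable_of_hasCompactSupport hs.mul_left
    have i2 : Integrable (fun x => h q * φ (x - q)) volume :=
      (hc.integrable_of_hasCompactSupport hs).const_mul _
    simp only [sub_mul]
    rw [integral_sub i1 i2, integral_const_mul, integral_sub_right_eq_self φ q, hφ.integral_eq, mul_one]
  have hδ : 0 ≤ δ := (abs_nonneg _).trans (hosc q (by simpa using hε.le))
  rw [e]
  refine (abs_integral_le_of_concentrated (K := δ * (K / ε)) (q := q) hε (fun x hx => ?_)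
    fun x hx => ?_).trans_eq ?_
  · rw [abs_mul]
    exact mul_le_mul (hosc x hx) (hφ.abs_le _) (abs_nonneg _) hδ
  · rw [hφ.eq_zero _ hx, mul_zero]
  · field_simp

/-- The commutator of mollification and transport is controlled by the oscillation. -/
lemma abs_commutator_le {f b φ : ℝ → ℝ} {K ε q δ B : ℝ} (hε : 0 < ε)
    (hφ : IsMollifier K ε φ) (hf : Continuous f) (hb : Differentiable ℝ b)
    (hb' : Continuous (deriv b)) (hB : ∀ x, |deriv b x| ≤ B)
    (hosc : ∀ x, |x - q| ≤ ε → |f x - f q| ≤ δ) :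
    |(∫ x, f x * deriv (fun y => b y * φ (y - q)) x) - b q * ∫ x, f x * deriv φ (x - q)| ≤
      4 * B * K * δ := by
  have hB0 : 0 ≤ B := (abs_nonneg _).trans (hB 0)
  have hδ : 0 ≤ δ := (abs_nonneg _).trans (hosc q (by simpa using hε.le))
  have hφd : ∀ x, HasDerivAt (fun y => φ (y - q)) (deriv φ (x - q)) x := fun x =>
    ((hφ.contDiff.differentiable (by simp) _).hasDerivAt (x := x - q)).comp_sub_const x q
  have hc : Continuous fun x => φ (x - q) := hφ.contDiff.continuous.comp (by fun_prop)
  have hc' : Continuous fun x => deriv φ (x - q) :=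
    (hφ.contDiff.continuous_deriv (by simp)).comp (by fun_prop)
  have hs : HasCompactSupport fun x => φ (x - q) :=
    hφ.hasCompactSupport.comp_homeomorph (Homeomorph.subRight q)
  have hs' : HasCompactSupport fun x => deriv φ (x - q) :=
    hφ.hasCompactSupport.deriv.comp_homeomorph (Homeomorph.subRight q)
  let ψ : ℝ → ℝ := fun x => (b x - b q) * φ (x - q)
  -- After subtraction of `b q`, the commutator is the pairing of `f` with the derivative of a
  -- compactly supported function. That derivative has integral zero, so `f` may be replaced by its
  -- oscillation `f - f q`.
  let ψ' : ℝ → ℝ := fun x => deriv b x * φ (x - q) + (b x - b q) * deriv φ (x - q)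
  have hψ : ∀ x, HasDerivAt ψ (ψ' x) x := fun x =>
    ((hb x).hasDerivAt.sub_const _).mul (hφd x)
  have hψc : Continuous ψ' :=
    (hb'.mul hc).add ((hb.continuous.sub continuous_const).mul hc')
  have hψs : HasCompactSupport ψ' := hs.mul_left.add hs'.mul_left
  have hψi : Integrable ψ' volume := hψc.integrable_of_hasCompactSupport hψs
  have hψ0 : ∫ x, ψ' x = 0 :=
    integral_eq_zero_of_hasDerivAt_of_integrable hψ hψi
      ((((hb.continuous.sub continuous_const).mul hc).integrable_of_hasCompactSupport hs.mul_left))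
  have hder : ∀ x, deriv (fun y => b y * φ (y - q)) x = ψ' x + b q * deriv φ (x - q) := fun x => by
    rw [((hb x).hasDerivAt.fun_mul (hφd x)).deriv]
    simp only [ψ']
    ring
  have hi1 : Integrable (fun x => f x * ψ' x) volume :=
    (hf.mul hψc).integrable_of_hasCompactSupport hψs.mul_left
  have hi2 : Integrable (fun x => f x * (b q * deriv φ (x - q))) volume :=
    (hf.mul (continuous_const.mul hc')).integrable_of_hasCompactSupport
      (hs'.mul_left (f := fun _ => b q)).mul_left
  have e : (∫ x, f x * deriv (fun y => b y * φ (y - q)) x) - b q * ∫ x, f x * deriv φ (x - q) =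
      ∫ x, (f x - f q) * ψ' x := by
    simp only [hder, mul_add, sub_mul]
    rw [integral_add hi1 hi2, integral_sub hi1 (hψi.const_mul _), integral_const_mul, hψ0,
      ← integral_const_mul]
    have : ∀ x, f x * (b q * deriv φ (x - q)) = b q * (f x * deriv φ (x - q)) := fun x => by ring
    simp only [this]
    ring
  rw [e]
  refine (abs_integral_le_of_concentrated (K := δ * (2 * B * (K / ε))) (q := q) hε
    (fun x hx => ?_) fun x hx => ?_).trans_eq ?_
  · rw [abs_mul]
    refine mul_le_mul (hosc x hx) ?_ (abs_nonneg _) hδ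
    -- The gain `ε` from the Lipschitz bound lowers the size `K / ε ^ 2` of `deriv φ` to `K / ε`,
    -- which the length `2 * ε` of the interval absorbs.
    have hlip : |b x - b q| ≤ B * ε := by
      have := Convex.norm_image_sub_le_of_norm_deriv_le (f := b) (s := univ) (x := q) (y := x)
        (C := B) (fun y _ => hb y) (fun y _ => hB y) convex_univ (mem_univ _) (mem_univ _)
      simp only [Real.norm_eq_abs] at this
      exact this.trans (by gcongr)
    calc |ψ' x| ≤ |deriv b x| * |φ (x - q)| + |b x - b q| * |deriv φ (x - q)| := by
          rw [← abs_mul, ← abs_mul]; exact abs_add_le _ _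
      _ ≤ B * (K / ε) + B * ε * (K / ε ^ 2) := by
          gcongr
          · exact hB x
          · exact hφ.abs_le _
          · exact hφ.abs_deriv_le _
      _ = _ := by field_simp; ring
  · simp only [ψ']
    rw [hφ.eq_zero _ hx, hφ.deriv_eq_zero _ hx]
    ring
  · field_simp; ring

/-- A continuous distributional solution of `f_t + b f_x = g` satisfies the
corresponding ordinary differential equation along the characteristics of `b`. -/
lemma hasDerivAt_along_characteristic {f b g : ℝ → ℝ → ℝ} {q : ℝ → ℝ} {T₀ A B : ℝ}
    (hf : ContinuousOn (fun p : ℝ × ℝ => f p.1 p.2) (Icc 0 T₀ ×ˢ univ))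
    (hg : ContinuousOn (fun p : ℝ × ℝ => g p.1 p.2) (Icc 0 T₀ ×ˢ univ))
    (hfA : ∀ t ∈ Icc 0 T₀, ∀ x, |f t x| ≤ A)
    (hb : ∀ t ∈ Icc 0 T₀, Differentiable ℝ (b t))
    (hb' : ∀ t ∈ Icc 0 T₀, Continuous (deriv (b t)))
    (hB : ∀ t ∈ Icc 0 T₀, ∀ x, |deriv (b t) x| ≤ B)
    (hqc : ContinuousOn q (Icc 0 T₀))
    (hq : ∀ t ∈ Ioo 0 T₀, HasDerivAt q (b t (q t)) t)
    (heq : ∀ φ : ℝ → ℝ, ContDiff ℝ ∞ φ → HasCompactSupport φ → ∀ t ∈ Ioo 0 T₀,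
      HasDerivAt (fun t' => ∫ x, f t' x * φ x)
        ((∫ x, f t x * deriv (fun y => b t y * φ y) x) + ∫ x, g t x * φ x) t)
    {t : ℝ} (ht : t ∈ Ioo 0 T₀) :
    HasDerivAt (fun t' => f t' (q t')) (g t (q t)) t := by
  obtain ⟨K, hK, hmol⟩ := exists_isMollifier
  -- The zero function is a dummy value for `ε ≤ 0`; the limit is taken from the right at `0`.
  have hmol' : ∀ ε : ℝ, ∃ φ, 0 < ε → IsMollifier K ε φ := fun ε => by
    by_cases h : 0 < ε
    · obtain ⟨φ, hφ⟩ := hmol ε h; exact ⟨φ, fun _ => hφ⟩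
    · exact ⟨0, fun h' => absurd h' h⟩
  choose φ hφ using hmol'
  have hslice : ∀ h : ℝ → ℝ → ℝ,
      ContinuousOn (fun p : ℝ × ℝ => h p.1 p.2) (Icc 0 T₀ ×ˢ univ) → ∀ τ ∈ Icc 0 T₀,
      Continuous (h τ) := fun h hh τ hτ => by
    rw [← continuousOn_univ]
    exact hh.comp (f := fun x => (τ, x)) (by fun_prop) fun x _ => ⟨hτ, mem_univ _⟩
  have hsub : ∀ {τ : ℝ}, τ ∈ Ioo 0 T₀ → τ ∈ Icc 0 T₀ := fun h => Ioo_subset_Icc_self h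
  have hnhds : ∀ τ ∈ Ioo 0 T₀, Icc 0 T₀ ∈ 𝓝 τ := fun τ hτ => Icc_mem_nhds hτ.1 hτ.2
  have hB0 : 0 ≤ B := (abs_nonneg _).trans (hB t (hsub ht) 0)
  -- The mollified values are differentiable along the path; uniform convergence of their
  -- derivatives and pointwise convergence of the values give the claim.
  refine hasDerivAt_of_tendstoUniformlyOn (l := 𝓝[>] (0 : ℝ)) (s := Ioo 0 T₀) isOpen_Ioo
    (f := fun ε t' => ∫ x, f t' x * φ ε (x - q t'))
    (f' := fun ε t' => (∫ x, f t' x * deriv (fun y => b t' y * φ ε (y - q t')) x) +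
      (∫ x, g t' x * φ ε (x - q t')) - b t' (q t') * ∫ x, f t' x * deriv (φ ε) (x - q t'))
    (g := fun t' => f t' (q t')) (g' := fun t' => g t' (q t')) ?_ ?_ ?_ ht
  · rw [Metric.tendstoUniformlyOn_iff]
    intro r hr
    -- The commutator contributes `4 * B * K * δ` and the source `2 * K * δ`; the summand `1` keeps
    -- the denominator positive and the factor `2` makes the final bound strict.
    set δ : ℝ := r / (2 * (4 * B * K + 2 * K + 1))
    have hδ : 0 < δ := by positivity
    obtain ⟨ε₁, hε₁, h1⟩ := exists_uniform_oscillation hf hqc hδ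
    obtain ⟨ε₂, hε₂, h2⟩ := exists_uniform_oscillation hg hqc hδ
    filter_upwards [Ioo_mem_nhdsGT (lt_min hε₁ hε₂)] with ε hε τ hτ
    have k1 := abs_commutator_le hε.1 (hφ ε hε.1) (hslice f hf τ (hsub hτ)) (hb τ (hsub hτ))
      (hb' τ (hsub hτ)) (hB τ (hsub hτ))
      fun x hx => h1 τ (hsub hτ) x (hx.trans (hε.2.le.trans (min_le_left _ _)))
    have k2 := abs_integral_mollifier_sub_le hε.1 (hφ ε hε.1) (hslice g hg τ (hsub hτ))
      fun x hx => h2 τ (hsub hτ) x (hx.trans (hε.2.le.trans (min_le_right _ _)))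
    rw [dist_comm, Real.dist_eq]
    have hlt : 4 * B * K * δ + 2 * K * δ < r := by
      have : (2 * (4 * B * K + 2 * K + 1)) * δ = r := by
        simp only [δ]; field_simp
      nlinarith [mul_nonneg (mul_nonneg hB0 hK) hδ.le, mul_nonneg hK hδ.le]
    refine lt_of_le_of_lt ?_ hlt
    refine le_trans ?_ (add_le_add k1 k2)
    refine le_trans (le_of_eq ?_) (abs_add_le _ _)
    congr 1
    ring
  · filter_upwards [self_mem_nhdsWithin] with ε hε τ hτ
    have hε' : 0 < ε := hε
    have hm := hφ ε hε'
    refine hasDerivAt_integral_moving (A := A) hm.contDiff hm.hasCompactSupport ?_ ?_ ?_ (hq τ hτ) ?_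
    · filter_upwards [hnhds τ hτ] with τ' h'
      exact hslice f hf τ' h'
    · filter_upwards [hnhds τ hτ] with τ' h'
      exact hfA τ' h'
    · intro x
      have h1 := hf.continuousAt (x := (τ, x)) (prod_mem_nhds (hnhds τ hτ) univ_mem)
      exact h1.tendsto.comp (f := fun t' => (t', x)) (by
        exact (Continuous.tendsto (by fun_prop) τ))
    · exact heq _ (hm.contDiff.comp (contDiff_id.sub contDiff_const))
        (hm.hasCompactSupport.comp_homeomorph (Homeomorph.subRight (q τ))) τ hτ
  · intro τ hτ
    rw [Metric.tendsto_nhds]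
    intro r hr
    have hδ : 0 < r / (2 * K + 1) := by positivity
    obtain ⟨ε₁, hε₁, h1⟩ := exists_uniform_oscillation hf hqc hδ
    filter_upwards [Ioo_mem_nhdsGT hε₁] with ε hε
    have k2 := abs_integral_mollifier_sub_le hε.1 (hφ ε hε.1) (hslice f hf τ (hsub hτ))
      fun x hx => h1 τ (hsub hτ) x (hx.trans hε.2.le)
    rw [Real.dist_eq]
    refine k2.trans_lt ?_
    rw [← mul_div_assoc, div_lt_iff₀ (by positivity)]
    nlinarith

/-! ### The logarithmic weight and the inversion of `1 - ∂ₓ²` -/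

lemma one_le_log_weight {β : ℝ} (hβ : 0 < β) (x : ℝ) :
    1 ≤ Real.log (Real.exp 1 + β + |x|) := by
  rw [Real.le_log_iff_exp_le (by positivity)]
  linarith [abs_nonneg x]

lemma logWeight_pos {β : ℝ} (hβ : 0 < β) (x : ℝ) : 0 < logWeight β x :=
  Real.rpow_pos_of_pos (one_pos.trans_le (one_le_log_weight hβ x)) _

lemma continuous_logWeight {β : ℝ} (hβ : 0 < β) : Continuous (logWeight β) := by
  unfold logWeight
  refine Continuous.rpow_const (Continuous.log (by fun_prop) fun x => by positivity)
    fun x => Or.inr hβ.le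

/-- The weight is moderate with respect to `exp (|x| / 2)`. -/
lemma exists_logWeight_le {β : ℝ} (hβ : 0 < β) :
    ∃ D : ℝ, 0 < D ∧ ∀ x y, logWeight β x ≤ D * Real.exp (|x - y| / 2) * logWeight β y := by
  have hc1 : (1 : ℝ) ≤ max 1 (2 * β) := le_max_left _ _
  have hc2 : 2 * β ≤ max 1 (2 * β) := le_max_right _ _
  -- The exponential rate `1 / (2 * β)` becomes `1 / 2` after raising to the power `β`. Both `c ≥ 1`
  -- and `c ≥ 2 * β` are needed for `1 + d ≤ c * (1 + d / (2 * β))`.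
  set c : ℝ := max 1 (2 * β)
  refine ⟨c ^ β, by positivity, fun x y => ?_⟩
  set d : ℝ := |x - y|
  have hd : 0 ≤ d := abs_nonneg _
  have hA : 1 ≤ Real.exp 1 + β + |y| := by
    linarith [abs_nonneg y, Real.add_one_le_exp (1 : ℝ)]
  have hlog : Real.log (Real.exp 1 + β + |x|) ≤ Real.log (Real.exp 1 + β + |y|) * (1 + d) := by
    have h1 : Real.exp 1 + β + |x| ≤ (Real.exp 1 + β + |y|) * (1 + d) := by
      have : |x| ≤ |y| + d := by
        have := abs_sub_abs_le_abs_sub x y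
        linarith
      nlinarith
    have h2 := Real.log_le_log (by positivity) h1
    rw [Real.log_mul (by positivity) (by positivity)] at h2
    have h3 : Real.log (1 + d) ≤ d := by
      have := Real.log_le_sub_one_of_pos (x := 1 + d) (by positivity)
      linarith
    nlinarith [one_le_log_weight hβ y]
  have hexp : 1 + d ≤ c * Real.exp (d / (2 * β)) := by
    have h1 := Real.add_one_le_exp (d / (2 * β))
    have h2 : d = 2 * β * (d / (2 * β)) := by field_simp
    have h3 : 0 ≤ d / (2 * β) := by positivity
    nlinarith
  have hpos : 0 ≤ Real.log (Real.exp 1 + β + |x|) :=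
    zero_le_one.trans (one_le_log_weight hβ x)
  have hposy : 0 ≤ Real.log (Real.exp 1 + β + |y|) :=
    zero_le_one.trans (one_le_log_weight hβ y)
  calc logWeight β x
      ≤ (c * Real.exp (d / (2 * β)) * Real.log (Real.exp 1 + β + |y|)) ^ β := by
        refine Real.rpow_le_rpow hpos (hlog.trans ?_) hβ.le
        rw [mul_comm]
        gcongr
    _ = _ := by
        rw [Real.mul_rpow (by positivity) hposy, Real.mul_rpow (by positivity) (by positivity),
          ← Real.exp_mul]
        congr 3
        field_simp

/-- One-sided bound for a bounded solution of `z - z' ≤ A / w` with a moderate weight `w`. -/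
lemma mul_weight_le_of_sub_deriv_le {z z' w : ℝ → ℝ} {A B D : ℝ} (hw : ∀ x, 0 < w x)
    (hmod : ∀ x y, w x ≤ D * Real.exp (|x - y| / 2) * w y) (hD : 0 < D) (hA : 0 ≤ A)
    (hz : ∀ x, HasDerivAt z (z' x) x) (hB : ∀ x, |z x| ≤ B)
    (hle : ∀ x, (z x - z' x) * w x ≤ A) (x : ℝ) : z x * w x ≤ 2 * A * D := by
  set K : ℝ := A * D / w x
  -- An integrating factor for `z - z'` on `[x, ∞)`, corrected by an antiderivative of the bound `K
  -- * exp (-(y - x) / 2)`. Thus `H` is increasing; boundedness of `z` makes it tend to `0`, so `H x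
  -- ≤ 0`, that is, `z x ≤ 2 * K`.
  let H : ℝ → ℝ := fun y => Real.exp (-(y - x)) * z y - 2 * K * Real.exp (-(y - x) / 2)
  have hH : ∀ y, HasDerivAt H (Real.exp (-(y - x)) * (z' y - z y) +
      K * Real.exp (-(y - x) / 2)) y := fun y => by
    have h1 : HasDerivAt (fun y => -(y - x)) (-1) y := ((hasDerivAt_id y).sub_const x).neg
    have h2 := (h1.exp.fun_mul (hz y)).fun_sub (((h1.div_const 2).exp).const_mul (2 * K))
    convert! h2 using 1
    ring
  have hmono : MonotoneOn H (Ici x) := by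
    refine monotoneOn_of_deriv_nonneg (convex_Ici x)
      (fun y _ => (hH y).continuousAt.continuousWithinAt)
      (fun y _ => (hH y).differentiableAt.differentiableWithinAt) fun y hy => ?_
    rw [interior_Ici] at hy
    have hy' : 0 < y - x := sub_pos.2 hy
    rw [(hH y).deriv]
    have h1 : z y - z' y ≤ K * Real.exp ((y - x) / 2) := by
      have h2 := hmod x y
      rw [abs_sub_comm, abs_of_pos hy'] at h2
      have h3 : z y - z' y ≤ A / w y := by rw [le_div_iff₀ (hw y)]; exact hle y
      refine h3.trans ?_
      simp only [K]
      rw [div_le_iff₀ (hw y), div_mul_eq_mul_div, div_mul_eq_mul_div, le_div_iff₀ (hw x)]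
      calc A * w x ≤ A * (D * Real.exp ((y - x) / 2) * w y) := by gcongr
        _ = _ := by ring
    have h4 : Real.exp (-(y - x)) * Real.exp ((y - x) / 2) = Real.exp (-(y - x) / 2) := by
      rw [← Real.exp_add]; congr 1; ring
    have h5 := mul_le_mul_of_nonneg_left h1 (Real.exp_pos (-(y - x))).le
    have h6 : Real.exp (-(y - x)) * (K * Real.exp ((y - x) / 2)) =
        K * Real.exp (-(y - x) / 2) := by rw [← h4]; ring
    linarith
  have hlim : Tendsto H atTop (𝓝 0) := by
    have e1 : Tendsto (fun y => Real.exp (-(y - x))) atTop (𝓝 0) :=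
      Real.tendsto_exp_neg_atTop_nhds_zero.comp (tendsto_atTop_add_const_right _ (-x) tendsto_id)
    have e2 : Tendsto (fun y => Real.exp (-(y - x) / 2)) atTop (𝓝 0) := by
      have : Tendsto (fun y => (y - x) / 2) atTop atTop :=
        (tendsto_atTop_add_const_right _ (-x) tendsto_id).atTop_div_const two_pos
      have := Real.tendsto_exp_neg_atTop_nhds_zero.comp this
      refine this.congr fun y => ?_
      simp only [Function.comp]
      congr 1; ring
    have e3 : Tendsto (fun y => Real.exp (-(y - x)) * z y) atTop (𝓝 0) := by
      refine squeeze_zero_norm (a := fun y => Real.exp (-(y - x)) * B) (fun y => ?_) ?_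
      · rw [norm_mul, Real.norm_of_nonneg (Real.exp_pos _).le]
        gcongr
        exact hB y
      · simpa using e1.mul_const B
    have h8 := e3.sub (e2.const_mul (2 * K))
    rw [mul_zero, sub_zero] at h8
    exact h8
  have hx : H x ≤ 0 := ge_of_tendsto hlim (by
    filter_upwards [eventually_ge_atTop x] with y hy
    exact hmono self_mem_Ici hy hy)
  simp only [H, sub_self, neg_zero, Real.exp_zero, zero_div, one_mul, mul_one, K] at hx
  have h7 : z x ≤ 2 * (A * D / w x) := by linarith
  calc z x * w x ≤ 2 * (A * D / w x) * w x := by have := hw x; gcongr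
    _ = _ := by have := (hw x).ne'; field_simp

lemma abs_mul_weight_le_of_sub_deriv {z z' w : ℝ → ℝ} {A B D : ℝ} (hw : ∀ x, 0 < w x)
    (hmod : ∀ x y, w x ≤ D * Real.exp (|x - y| / 2) * w y) (hD : 0 < D) (hA : 0 ≤ A)
    (hz : ∀ x, HasDerivAt z (z' x) x) (hB : ∀ x, |z x| ≤ B)
    (hle : ∀ x, |z x - z' x| * w x ≤ A) (x : ℝ) : |z x| * w x ≤ 2 * A * D := by
  have h1 := mul_weight_le_of_sub_deriv_le hw hmod hD hA hz hB
    (fun y => (mul_le_mul_of_nonneg_right (le_abs_self _) (hw y).le).trans (hle y)) x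
  have h2 := mul_weight_le_of_sub_deriv_le (z := fun y => -z y) (z' := fun y => -z' y) hw hmod hD
    hA (fun y => (hz y).fun_neg) (fun y => by rw [abs_neg]; exact hB y)
    (fun y => (mul_le_mul_of_nonneg_right (neg_le_abs (z y - z' y)) (hw y).le).trans (hle y)
      |> le_trans (le_of_eq (by ring))) x
  rcases abs_cases (z x) with h | h <;> rw [h.1] <;> assumption

/-- Weighted bounds for `u`, `u_x`, `u_xx` in terms of the momentum `u - u_xx`. -/
lemma BoundedC2.weighted_bounds {u w : ℝ → ℝ} {A B D : ℝ} (hu : BoundedC2 B u)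
    (hw : ∀ x, 0 < w x) (hmod : ∀ x y, w x ≤ D * Real.exp (|x - y| / 2) * w y) (hD : 0 < D)
    (hA : 0 ≤ A) (hle : ∀ x, |momentum u x| * w x ≤ A) (x : ℝ) :
    |u x| * w x ≤ 2 * A * D ∧ |deriv u x| * w x ≤ 2 * A * D ∧
      |deriv (deriv u) x| * w x ≤ A + 2 * A * D := by
  have d0 : ∀ y, HasDerivAt u (deriv u y) y := fun y => (hu.differentiable y).hasDerivAt
  have d1 : ∀ y, HasDerivAt (deriv u) (deriv (deriv u) y) y := fun y =>
    (hu.differentiable_deriv y).hasDerivAt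
  have hp : |u x + deriv u x| * w x ≤ 2 * A * D :=
    abs_mul_weight_le_of_sub_deriv (z := fun y => u y + deriv u y) (B := B + B) hw hmod hD hA
      (fun y => (d0 y).fun_add (d1 y))
      (fun y => (abs_add_le _ _).trans (add_le_add (hu.abs_le y) (hu.abs_deriv_le y)))
      (fun y => by
        refine le_trans (le_of_eq ?_) (hle y)
        rw [momentum]; ring_nf) x
  -- Here `z = u - u_x` satisfies `z + z' = m`; the reflection `y ↦ -y` reduces this to the previous
  -- case.
  have hm : |u x - deriv u x| * w x ≤ 2 * A * D := by
    have := abs_mul_weight_le_of_sub_deriv (z := fun y => u (-y) - deriv u (-y))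
      (z' := fun y => -deriv u (-y) + deriv (deriv u) (-y)) (w := fun y => w (-y)) (B := B + B)
      (fun y => hw _) (fun a b => by
        have := hmod (-a) (-b)
        rwa [← neg_sub', abs_neg] at this) hD hA
      (fun y => by
        have e0 := (d0 (-y)).comp y (hasDerivAt_neg y)
        have e1 := (d1 (-y)).comp y (hasDerivAt_neg y)
        convert! e0.fun_sub e1 using 1
        ring)
      (fun y => (abs_sub _ _).trans (add_le_add (hu.abs_le _) (hu.abs_deriv_le _)))
      (fun y => by
        refine le_trans (le_of_eq ?_) (hle (-y))
        rw [momentum]; ring_nf) (-x)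
    simpa using this
  have hwx := (hw x).le
  have k0 : |u x| * w x ≤ 2 * A * D := by
    have : |u x| ≤ (|u x + deriv u x| + |u x - deriv u x|) / 2 := by
      have := abs_add_le (u x + deriv u x) (u x - deriv u x)
      rw [show u x + deriv u x + (u x - deriv u x) = 2 * u x by ring, abs_mul, abs_two] at this
      linarith
    nlinarith
  have k1 : |deriv u x| * w x ≤ 2 * A * D := by
    have : |deriv u x| ≤ (|u x + deriv u x| + |u x - deriv u x|) / 2 := by
      have := abs_sub (u x + deriv u x) (u x - deriv u x)
      rw [show u x + deriv u x - (u x - deriv u x) = 2 * deriv u x by ring, abs_mul, abs_two]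
        at this
      linarith
    nlinarith
  refine ⟨k0, k1, ?_⟩
  have : |deriv (deriv u) x| ≤ |momentum u x| + |u x| := by
    have := abs_sub (u x) (momentum u x)
    rw [show u x - momentum u x = deriv (deriv u) x by rw [momentum]; ring] at this
    linarith
  nlinarith [hle x]

/-! ### Characteristics and Gronwall's inequality -/

/-- Picard-Lindelöf is started at the prescribed point `(t₁, x₁)`, so every point is joined to time
`0` without showing that the flow map is onto. -/
lemma exists_characteristic {b : ℝ → ℝ → ℝ} {T₀ B₀ B₁ : ℝ}
    (hbc : ∀ x, ContinuousOn (fun t => b t x) (Icc 0 T₀))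
    (hb : ∀ t ∈ Icc 0 T₀, Differentiable ℝ (b t))
    (hB₀ : ∀ t ∈ Icc 0 T₀, ∀ x, |b t x| ≤ B₀)
    (hB₁ : ∀ t ∈ Icc 0 T₀, ∀ x, |deriv (b t) x| ≤ B₁)
    {t₁ : ℝ} (ht₁ : t₁ ∈ Icc 0 T₀) (x₁ : ℝ) :
    ∃ q : ℝ → ℝ, q t₁ = x₁ ∧ ContinuousOn q (Icc 0 T₀) ∧
      (∀ t ∈ Ioo 0 T₀, HasDerivAt q (b t (q t)) t) ∧ |x₁ - q 0| ≤ B₀ * T₀ := by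
  have hT₀ : 0 ≤ T₀ := ht₁.1.trans ht₁.2
  have h0 : (0 : ℝ) ∈ Icc 0 T₀ := ⟨le_rfl, hT₀⟩
  have hB₀n : 0 ≤ B₀ := (abs_nonneg _).trans (hB₀ 0 h0 0)
  have hB₁n : 0 ≤ B₁ := (abs_nonneg _).trans (hB₁ 0 h0 0)
  -- Speed at most `B₀` keeps the curve in the ball of radius `B₀ * T₀` throughout `[0, T₀]`, so
  -- existence is not merely local.
  have hPL : IsPicardLindelof b (⟨t₁, ht₁⟩ : Icc 0 T₀) x₁ ⟨B₀ * T₀, by positivity⟩ 0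
      ⟨B₀, hB₀n⟩ ⟨B₁, hB₁n⟩ := by
    refine ⟨fun t ht => ?_, fun x _ => hbc x, fun t ht x _ => hB₀ t ht x, ?_⟩
    · exact (lipschitzWith_of_nnnorm_deriv_le (hb t ht) fun x => hB₁ t ht x).lipschitzOnWith
    · simp only [NNReal.coe_zero, sub_zero]
      refine mul_le_mul_of_nonneg_left (max_le ?_ ?_) hB₀n <;> linarith [ht₁.1, ht₁.2]
  obtain ⟨q, hq1, hq⟩ := hPL.exists_eq_forall_mem_Icc_hasDerivWithinAt₀
  refine ⟨q, hq1, fun t ht => (hq t ht).continuousWithinAt,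
    fun t ht => (hq t (Ioo_subset_Icc_self ht)).hasDerivAt (Icc_mem_nhds ht.1 ht.2), ?_⟩
  have h1 := (convex_Icc 0 T₀).norm_image_sub_le_of_norm_hasDerivWithin_le hq
    (C := B₀) (fun t ht => hB₀ t ht _) h0 ht₁
  rw [hq1, sub_zero, Real.norm_eq_abs, Real.norm_eq_abs, abs_of_nonneg ht₁.1] at h1
  exact h1.trans (mul_le_mul_of_nonneg_left ht₁.2 hB₀n)

/-- Gronwall's inequality for a function whose derivative exists in the open interval. -/
lemma le_exp_mul_of_deriv_le {N N' : ℝ → ℝ} {K T₀ : ℝ} (hc : ContinuousOn N (Icc 0 T₀))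
    (hN : ∀ t ∈ Ioo 0 T₀, HasDerivAt N (N' t) t) (hle : ∀ t ∈ Ioo 0 T₀, N' t ≤ K * N t)
    {t : ℝ} (ht : t ∈ Icc 0 T₀) : N t ≤ Real.exp (K * t) * N 0 := by
  have hd : ∀ t ∈ Ioo 0 T₀, HasDerivAt (fun t => Real.exp (-(K * t)) * N t)
      (Real.exp (-(K * t)) * (N' t - K * N t)) t := fun t ht => by
    have h1 : HasDerivAt (fun t => -(K * t)) (-K) t := by
      simpa using ((hasDerivAt_id t).const_mul K).fun_neg
    convert! h1.exp.fun_mul (hN t ht) using 1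
    ring
  have hanti : AntitoneOn (fun t => Real.exp (-(K * t)) * N t) (Icc 0 T₀) := by
    refine antitoneOn_of_deriv_nonpos (convex_Icc _ _) (by fun_prop) (fun t ht => ?_)
      fun t ht => ?_ <;> rw [interior_Icc] at ht
    · exact (hd t ht).differentiableAt.differentiableWithinAt
    · rw [(hd t ht).deriv]
      exact mul_nonpos_of_nonneg_of_nonpos (Real.exp_pos _).le (by linarith [hle t ht])
  have h := hanti (left_mem_Icc.2 (ht.1.trans ht.2)) ht ht.1
  simp only [mul_zero, neg_zero, Real.exp_zero, one_mul] at h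
  calc N t = Real.exp (K * t) * (Real.exp (-(K * t)) * N t) := by
        rw [← mul_assoc, ← Real.exp_add]; simp
    _ ≤ _ := by gcongr

/-! ### Bounded classical curves and their energy along characteristics -/

/-- Time slices that vary continuously in the supremum norm are jointly continuous. -/
lemma continuousOn_prod_of_uniform {h : ℝ → ℝ → ℝ} {S : Set ℝ} (hc : ∀ t ∈ S, Continuous (h t))
    (hu : ∀ t ∈ S, ∀ δ > 0, ∀ᶠ t' in 𝓝[S] t, ∀ x, |h t' x - h t x| ≤ δ) :
    ContinuousOn (fun p : ℝ × ℝ => h p.1 p.2) (S ×ˢ univ) := by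
  rintro ⟨t, x⟩ ⟨ht, -⟩
  rw [ContinuousWithinAt, nhdsWithin_prod_eq, nhdsWithin_univ, Metric.tendsto_nhds]
  intro ε hε
  have h1 := hu t ht (ε / 3) (by positivity)
  have h2 := (hc t ht).continuousAt.eventually (Metric.ball_mem_nhds (h t x) (ε := ε / 3)
    (by positivity))
  filter_upwards [h1.prod_mk h2] with p hp
  have hp1 := hp.1 p.2
  have hp2 := hp.2
  rw [Real.dist_eq] at hp2
  rw [Real.dist_eq]
  have := abs_add_le (h p.1 p.2 - h t p.2) (h t p.2 - h t x)
  rw [sub_add_sub_cancel] at this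
  linarith

/-- A triple on `[0, T₀]` with the regularity that the Sobolev embedding provides, solving the
system in the sense of distributions. -/
structure IsClassicalCurve (B T₀ : ℝ) (ρ u v : ℝ → ℝ → ℝ) : Prop where
  continuousOn_rho : ContinuousOn (fun p : ℝ × ℝ => ρ p.1 p.2) (Icc 0 T₀ ×ˢ univ)
  continuousOn_u : ContinuousOn (fun p : ℝ × ℝ => u p.1 p.2) (Icc 0 T₀ ×ˢ univ)
  continuousOn_u1 : ContinuousOn (fun p : ℝ × ℝ => deriv (u p.1) p.2) (Icc 0 T₀ ×ˢ univ)
  continuousOn_m : ContinuousOn (fun p : ℝ × ℝ => momentum (u p.1) p.2) (Icc 0 T₀ ×ˢ univ)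
  continuousOn_v : ContinuousOn (fun p : ℝ × ℝ => v p.1 p.2) (Icc 0 T₀ ×ˢ univ)
  continuousOn_v1 : ContinuousOn (fun p : ℝ × ℝ => deriv (v p.1) p.2) (Icc 0 T₀ ×ˢ univ)
  continuousOn_n : ContinuousOn (fun p : ℝ × ℝ => momentum (v p.1) p.2) (Icc 0 T₀ ×ˢ univ)
  abs_rho_le : ∀ t ∈ Icc 0 T₀, ∀ x, |ρ t x| ≤ B
  bounded_u : ∀ t ∈ Icc 0 T₀, BoundedC2 B (u t)
  bounded_v : ∀ t ∈ Icc 0 T₀, BoundedC2 B (v t)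
  equation_rho : ∀ φ : ℝ → ℝ, ContDiff ℝ ∞ φ → HasCompactSupport φ → ∀ t ∈ Ioo 0 T₀,
    HasDerivAt (fun t' => ∫ x, ρ t' x * φ x) (∫ x, ρ t x * u t x * v t x * deriv φ x) t
  equation_m : ∀ φ : ℝ → ℝ, ContDiff ℝ ∞ φ → HasCompactSupport φ → ∀ t ∈ Ioo 0 T₀,
    HasDerivAt (fun t' => ∫ x, momentum (u t') x * φ x)
      (-transportPairing (u t) (v t) (momentum (u t)) φ - ∫ x, (ρ t x) ^ 2 * u t x * φ x) t
  equation_n : ∀ φ : ℝ → ℝ, ContDiff ℝ ∞ φ → HasCompactSupport φ → ∀ t ∈ Ioo 0 T₀,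
    HasDerivAt (fun t' => ∫ x, momentum (v t') x * φ x)
      (-transportPairing (v t) (u t) (momentum (v t)) φ + ∫ x, (ρ t x) ^ 2 * v t x * φ x) t

lemma BoundedC2.abs_momentum_le {B : ℝ} {f : ℝ → ℝ} (hf : BoundedC2 B f) (x : ℝ) :
    |momentum f x| ≤ 2 * B := by
  have := abs_sub (f x) (deriv (deriv f) x)
  rw [momentum]
  linarith [hf.abs_le x, hf.abs_deriv2_le x]

lemma BoundedC2.continuous_momentum {B : ℝ} {f : ℝ → ℝ} (hf : BoundedC2 B f) :
    Continuous (momentum f) :=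
  hf.differentiable.continuous.sub hf.continuous_deriv2

lemma BoundedC2.hasDerivAt_mul {B : ℝ} {f g : ℝ → ℝ} (hf : BoundedC2 B f) (hg : BoundedC2 B g)
    (x : ℝ) : HasDerivAt (fun y => f y * g y) (deriv f x * g x + f x * deriv g x) x :=
  (hf.differentiable x).hasDerivAt.fun_mul (hg.differentiable x).hasDerivAt

lemma BoundedC2.deriv_mul {B : ℝ} {f g : ℝ → ℝ} (hf : BoundedC2 B f) (hg : BoundedC2 B g) :
    deriv (fun y => f y * g y) = fun x => deriv f x * g x + f x * deriv g x :=
  funext fun x => (hf.hasDerivAt_mul hg x).deriv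

lemma BoundedC2.abs_deriv_mul_le {B : ℝ} {f g : ℝ → ℝ} (hf : BoundedC2 B f)
    (hg : BoundedC2 B g) (x : ℝ) : |deriv f x * g x + f x * deriv g x| ≤ 2 * B ^ 2 := by
  have hB : 0 ≤ B := (abs_nonneg _).trans (hf.abs_le x)
  calc _ ≤ |deriv f x| * |g x| + |f x| * |deriv g x| := by
        rw [← abs_mul, ← abs_mul]; exact abs_add_le _ _
    _ ≤ B * B + B * B := by
        gcongr
        exacts [hf.abs_deriv_le x, hg.abs_le x, hf.abs_le x, hg.abs_deriv_le x]
    _ = _ := by ring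

/-- The product rule turns the conservative form `(ρ b)_x` into the transport form `b ρ_x` with
source `-ρ b_x`, as required by `hasDerivAt_along_characteristic`. -/
lemma integral_mul_deriv_eq {ρ b φ : ℝ → ℝ} (hρ : Continuous ρ) (hb : Differentiable ℝ b)
    (hb' : Continuous (deriv b)) (hφ : ContDiff ℝ ∞ φ) (hφc : HasCompactSupport φ) :
    ∫ x, ρ x * b x * deriv φ x =
      (∫ x, ρ x * deriv (fun y => b y * φ y) x) + ∫ x, -(ρ x * deriv b x) * φ x := by
  have hφd := hφ.differentiable (by simp)
  have hφ' : Continuous (deriv φ) := hφ.continuous_deriv (by simp)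
  have hd : ∀ x, deriv (fun y => b y * φ y) x = deriv b x * φ x + b x * deriv φ x := fun x =>
    ((hb x).hasDerivAt.fun_mul (hφd x).hasDerivAt).deriv
  simp only [hd]
  have hbc := hb.continuous
  have hφcont := hφ.continuous
  rw [← integral_add]
  · congr 1; ext x; ring
  · refine Continuous.integrable_of_hasCompactSupport (by fun_prop) ?_
    exact (hφc.mul_left.add hφc.deriv.mul_left).mul_left
  · refine Continuous.integrable_of_hasCompactSupport (by fun_prop) hφc.mul_left

/-- The scalar `c` carries the sign of the `ρ²` term, so that one argument covers `m` (`c = -1`) and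
`n` (`c = 1`). -/
lemma neg_transportPairing_eq {B : ℝ} {a b ρ φ : ℝ → ℝ} (ha : BoundedC2 B a)
    (hb : BoundedC2 B b) (hρ : Continuous ρ) (hφ : ContDiff ℝ ∞ φ) (hφc : HasCompactSupport φ)
    (c : ℝ) :
    -transportPairing a b (momentum a) φ + c * ∫ x, (ρ x) ^ 2 * a x * φ x =
      (∫ x, momentum a x * deriv (fun y => a y * b y * φ y) x) +
        ∫ x, (-(3 * b x * deriv a x * momentum a x) + c * ((ρ x) ^ 2 * a x)) * φ x := by
  have h1 := ha.differentiable.continuous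
  have h2 := hb.differentiable.continuous
  have h3 := ha.differentiable_deriv.continuous
  have h4 := ha.continuous_momentum
  have h5 := hφ.continuous
  have i1 : Integrable (fun x => 3 * b x * deriv a x * momentum a x * φ x) volume :=
    Continuous.integrable_of_hasCompactSupport (by fun_prop) hφc.mul_left
  have i2 : Integrable (fun x => (ρ x) ^ 2 * a x * φ x) volume :=
    Continuous.integrable_of_hasCompactSupport (by fun_prop) hφc.mul_left
  have e : ∀ x, (-(3 * b x * deriv a x * momentum a x) + c * ((ρ x) ^ 2 * a x)) * φ x =
      c * ((ρ x) ^ 2 * a x * φ x) - 3 * b x * deriv a x * momentum a x * φ x := fun x => by ring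
  simp only [e]
  rw [integral_sub (i2.const_mul c) i1, integral_const_mul, transportPairing]
  ring

namespace IsClassicalCurve

variable {B T₀ : ℝ} {ρ u v : ℝ → ℝ → ℝ} {q : ℝ → ℝ}

lemma hasDerivAt_rho (h : IsClassicalCurve B T₀ ρ u v) (hqc : ContinuousOn q (Icc 0 T₀))
    (hq : ∀ t ∈ Ioo 0 T₀, HasDerivAt q (u t (q t) * v t (q t)) t) {t : ℝ} (ht : t ∈ Ioo 0 T₀) :
    HasDerivAt (fun t' => ρ t' (q t'))
      (-(ρ t (q t) * (deriv (u t) (q t) * v t (q t) + u t (q t) * deriv (v t) (q t)))) t := by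
  have hd : ∀ t ∈ Icc 0 T₀, Differentiable ℝ fun y => u t y * v t y := fun t ht x =>
    ((h.bounded_u t ht).hasDerivAt_mul (h.bounded_v t ht) x).differentiableAt
  have hd' : ∀ t ∈ Icc 0 T₀, Continuous (deriv fun y => u t y * v t y) := fun t ht => by
    rw [(h.bounded_u t ht).deriv_mul (h.bounded_v t ht)]
    have hu := h.bounded_u t ht
    have hv := h.bounded_v t ht
    exact (hu.differentiable_deriv.continuous.mul hv.differentiable.continuous).add
      (hu.differentiable.continuous.mul hv.differentiable_deriv.continuous)
  refine hasDerivAt_along_characteristic (f := ρ) (b := fun t y => u t y * v t y)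
    (g := fun t x => -(ρ t x * (deriv (u t) x * v t x + u t x * deriv (v t) x)))
    (A := B) (B := 2 * B ^ 2) h.continuousOn_rho
    (h.continuousOn_rho.mul ((h.continuousOn_u1.mul h.continuousOn_v).add
      (h.continuousOn_u.mul h.continuousOn_v1))).neg h.abs_rho_le hd hd' (fun t ht x => ?_) hqc hq
      (fun φ hφ hφc t ht => ?_) ht
  · rw [(h.bounded_u t ht).deriv_mul (h.bounded_v t ht)]
    exact (h.bounded_u t ht).abs_deriv_mul_le (h.bounded_v t ht) x
  · have ht' := Ioo_subset_Icc_self ht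
    have hρ : Continuous (ρ t) := by
      rw [← continuousOn_univ]
      exact h.continuousOn_rho.comp (f := fun x => (t, x)) (by fun_prop) fun x _ => ⟨ht', mem_univ _⟩
    have e := integral_mul_deriv_eq hρ (hd t ht') (hd' t ht') hφ hφc
    rw [(h.bounded_u t ht').deriv_mul (h.bounded_v t ht')] at e
    rw [← e]
    simpa only [mul_assoc] using h.equation_rho φ hφ hφc t ht

/-- The equation for one momentum, along a characteristic. -/
lemma hasDerivAt_momentum {a b : ℝ → ℝ → ℝ} {c : ℝ}
    (hρ : ContinuousOn (fun p : ℝ × ℝ => ρ p.1 p.2) (Icc 0 T₀ ×ˢ univ))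
    (ha : ContinuousOn (fun p : ℝ × ℝ => a p.1 p.2) (Icc 0 T₀ ×ˢ univ))
    (ha1 : ContinuousOn (fun p : ℝ × ℝ => deriv (a p.1) p.2) (Icc 0 T₀ ×ˢ univ))
    (hm : ContinuousOn (fun p : ℝ × ℝ => momentum (a p.1) p.2) (Icc 0 T₀ ×ˢ univ))
    (hb : ContinuousOn (fun p : ℝ × ℝ => b p.1 p.2) (Icc 0 T₀ ×ˢ univ))
    (haB : ∀ t ∈ Icc 0 T₀, BoundedC2 B (a t)) (hbB : ∀ t ∈ Icc 0 T₀, BoundedC2 B (b t))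
    (heq : ∀ φ : ℝ → ℝ, ContDiff ℝ ∞ φ → HasCompactSupport φ → ∀ t ∈ Ioo 0 T₀,
      HasDerivAt (fun t' => ∫ x, momentum (a t') x * φ x)
        (-transportPairing (a t) (b t) (momentum (a t)) φ +
          c * ∫ x, (ρ t x) ^ 2 * a t x * φ x) t)
    (hqc : ContinuousOn q (Icc 0 T₀))
    (hq : ∀ t ∈ Ioo 0 T₀, HasDerivAt q (a t (q t) * b t (q t)) t) {t : ℝ} (ht : t ∈ Ioo 0 T₀) :
    HasDerivAt (fun t' => momentum (a t') (q t'))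
      (-(3 * b t (q t) * deriv (a t) (q t) * momentum (a t) (q t)) +
        c * ((ρ t (q t)) ^ 2 * a t (q t))) t := by
  refine hasDerivAt_along_characteristic (f := fun t => momentum (a t))
    (b := fun t y => a t y * b t y)
    (g := fun t x => -(3 * b t x * deriv (a t) x * momentum (a t) x) + c * ((ρ t x) ^ 2 * a t x))
    (A := 2 * B) (B := 2 * B ^ 2) hm
    ((((continuousOn_const.mul hb).mul ha1).mul hm).neg.add
      (continuousOn_const.mul ((hρ.pow 2).mul ha)))
    (fun t ht => (haB t ht).abs_momentum_le) (fun t ht x =>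
      ((haB t ht).hasDerivAt_mul (hbB t ht) x).differentiableAt) (fun t ht => ?_)
    (fun t ht x => ?_) hqc hq (fun φ hφ hφc t ht => ?_) ht
  · rw [(haB t ht).deriv_mul (hbB t ht)]
    exact ((haB t ht).differentiable_deriv.continuous.mul (hbB t ht).differentiable.continuous).add
      ((haB t ht).differentiable.continuous.mul (hbB t ht).differentiable_deriv.continuous)
  · rw [(haB t ht).deriv_mul (hbB t ht)]
    exact (haB t ht).abs_deriv_mul_le (hbB t ht) x
  · have ht' := Ioo_subset_Icc_self ht
    have hρt : Continuous (ρ t) := by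
      rw [← continuousOn_univ]
      exact hρ.comp (f := fun x => (t, x)) (by fun_prop) fun x _ => ⟨ht', mem_univ _⟩
    rw [← neg_transportPairing_eq (haB t ht') (hbB t ht') hρt hφ hφc]
    exact heq φ hφ hφc t ht

/-- The density of the energy that is propagated along characteristics. -/
def density (ρ u v : ℝ → ℝ) (x : ℝ) : ℝ := ρ x ^ 2 + momentum u x ^ 2 + momentum v x ^ 2

/-- The stretching term gives `6 * B ^ 2 * z ^ 2`. In the coupling term one factor `r` is bounded by
`B`, and `2 |z r| ≤ z ^ 2 + r ^ 2`, so the bound stays quadratic in `(z, r)`. -/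
lemma abs_deriv_sq_le {a b z r w B c : ℝ} (hB : 0 ≤ B) (ha : |a| ≤ B) (hb : |b| ≤ B)
    (hw : |w| ≤ B) (hr : |r| ≤ B) (hc : |c| = 1) :
    2 * z * (-(3 * a * b * z) + c * (r ^ 2 * w)) ≤ 7 * B ^ 2 * z ^ 2 + B ^ 2 * r ^ 2 := by
  have h1 : |a * b| ≤ B ^ 2 := by rw [abs_mul, sq]; gcongr
  have h2 : |c * (r * w)| ≤ B ^ 2 := by rw [abs_mul, hc, one_mul, abs_mul, sq]; gcongr
  have h3 : |z * r| ≤ (z ^ 2 + r ^ 2) / 2 := by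
    rw [abs_mul]
    nlinarith [sq_nonneg (|z| - |r|), sq_abs z, sq_abs r]
  have h4 : c * (r * w) * (z * r) ≤ B ^ 2 * ((z ^ 2 + r ^ 2) / 2) := by
    refine (le_abs_self _).trans ?_
    rw [abs_mul]
    gcongr
  nlinarith [mul_nonneg (sub_nonneg.2 ((neg_le_abs _).trans h1)) (sq_nonneg z)]

lemma exists_density_le (h : IsClassicalCurve B T₀ ρ u v) {t₁ : ℝ} (ht₁ : t₁ ∈ Icc 0 T₀)
    (x₁ : ℝ) : ∃ x₀, |x₁ - x₀| ≤ B ^ 2 * T₀ ∧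
      density (ρ t₁) (u t₁) (v t₁) x₁ ≤
        Real.exp (7 * B ^ 2 * t₁) * density (ρ 0) (u 0) (v 0) x₀ := by
  have h0 : (0 : ℝ) ∈ Icc 0 T₀ := ⟨le_rfl, ht₁.1.trans ht₁.2⟩
  have hB : 0 ≤ B := (abs_nonneg _).trans (h.abs_rho_le 0 h0 0)
  have hslice : ∀ x, ContinuousOn (fun t => u t x * v t x) (Icc 0 T₀) := fun x =>
    (h.continuousOn_u.mul h.continuousOn_v).comp (f := fun t => (t, x)) (by fun_prop)
      fun t ht => ⟨ht, mem_univ _⟩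
  obtain ⟨q, hq1, hqc, hq, hq0⟩ := exists_characteristic (b := fun t x => u t x * v t x)
    (B₀ := B ^ 2) (B₁ := 2 * B ^ 2) hslice
    (fun t ht x => ((h.bounded_u t ht).hasDerivAt_mul (h.bounded_v t ht) x).differentiableAt)
    (fun t ht x => by
      rw [abs_mul, sq]
      have h1 := (h.bounded_u t ht).abs_le x
      have h2 := (h.bounded_v t ht).abs_le x
      gcongr)
    (fun t ht x => by
      rw [(h.bounded_u t ht).deriv_mul (h.bounded_v t ht)]
      exact (h.bounded_u t ht).abs_deriv_mul_le (h.bounded_v t ht) x) ht₁ x₁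
  refine ⟨q 0, hq0, ?_⟩
  have hpath : ∀ g : ℝ → ℝ → ℝ,
      ContinuousOn (fun p : ℝ × ℝ => g p.1 p.2) (Icc 0 T₀ ×ˢ univ) →
      ContinuousOn (fun t => g t (q t)) (Icc 0 T₀) := fun g hg =>
    hg.comp (f := fun t => (t, q t)) (continuousOn_id.prodMk hqc) fun t ht => ⟨ht, mem_univ _⟩
  have hm := fun t (ht : t ∈ Ioo 0 T₀) => hasDerivAt_momentum (c := -1) h.continuousOn_rho
    h.continuousOn_u h.continuousOn_u1 h.continuousOn_m h.continuousOn_v h.bounded_u h.bounded_v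
    (fun φ hφ hφc t ht => by
      simpa only [neg_one_mul, ← sub_eq_add_neg] using h.equation_m φ hφ hφc t ht) hqc hq ht
  have hn := fun t (ht : t ∈ Ioo 0 T₀) => hasDerivAt_momentum (c := 1) h.continuousOn_rho
    h.continuousOn_v h.continuousOn_v1 h.continuousOn_n h.continuousOn_u h.bounded_v h.bounded_u
    (fun φ hφ hφc t ht => by
      simpa only [one_mul] using h.equation_n φ hφ hφc t ht) hqc
    -- The velocity is symmetric in `u` and `v`, so the same path serves both momenta.
    (fun t ht => by simpa only [mul_comm] using hq t ht) ht
  have hr := fun t (ht : t ∈ Ioo 0 T₀) => h.hasDerivAt_rho hqc hq ht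
  have key := le_exp_mul_of_deriv_le (N := fun t => density (ρ t) (u t) (v t) (q t))
    (K := 7 * B ^ 2)
    ((((hpath _ h.continuousOn_rho).pow 2).add ((hpath _ h.continuousOn_m).pow 2)).add
      ((hpath _ h.continuousOn_n).pow 2))
    (fun t ht => (((hr t ht).fun_pow 2).fun_add ((hm t ht).fun_pow 2)).fun_add
      ((hn t ht).fun_pow 2)) (fun t ht => ?_) ht₁
  · simpa only [hq1] using key
  · have ht' := Ioo_subset_Icc_self ht
    have hu := h.bounded_u t ht'
    have hv := h.bounded_v t ht'
    have e1 := abs_deriv_sq_le (z := momentum (u t) (q t)) (c := -1) hB (hv.abs_le (q t))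
      (hu.abs_deriv_le (q t)) (hu.abs_le (q t)) (h.abs_rho_le t ht' (q t)) (by simp)
    have e2 := abs_deriv_sq_le (z := momentum (v t) (q t)) (c := 1) hB (hu.abs_le (q t))
      (hv.abs_deriv_le (q t)) (hv.abs_le (q t)) (h.abs_rho_le t ht' (q t)) (by simp)
    have e3 := (neg_le_abs _).trans (hu.abs_deriv_mul_le hv (q t))
    have e4 := mul_nonneg (sub_nonneg.2 e3) (sq_nonneg (ρ t (q t)))
    -- The coefficient of `ρ²` is at most `(4 + 1 + 1) * B ^ 2`, from `(uv)_x` and the two coupling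
    -- terms; those of `m²` and `n²` are `7 * B ^ 2`.
    simp only [density]
    norm_num only [Nat.cast_ofNat, pow_one, Nat.add_one_sub_one]
    nlinarith [mul_nonneg (sq_nonneg B) (sq_nonneg (ρ t (q t)))]

end IsClassicalCurve

/-! ### From Sobolev solutions to bounded classical curves -/

lemma BoundedC2.mono {B B' : ℝ} {f : ℝ → ℝ} (hf : BoundedC2 B f) (h : B ≤ B') :
    BoundedC2 B' f :=
  ⟨hf.differentiable, hf.differentiable_deriv, hf.continuous_deriv2,
    fun x => (hf.abs_le x).trans h, fun x => (hf.abs_deriv_le x).trans h,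
    fun x => (hf.abs_deriv2_le x).trans h⟩

lemma IsContinuousCurve.eventually_hsNorm_le {σ C T₀ : ℝ} {T : EReal} {f : ℝ → ℝ → ℝ}
    (hf : IsContinuousCurve σ T f) (hC : 0 ≤ C) (hT : Icc 0 T₀ ⊆ timeIco T) {t : ℝ}
    (ht : t ∈ Icc 0 T₀) {δ : ℝ} (hδ : 0 < δ) :
    ∃ ε : ℝ≥0, C * ε ≤ δ ∧
      ∀ᶠ t' in 𝓝[Icc 0 T₀] t, hsNorm σ (fun x => f t' x - f t x) ≤ ε := by
  -- Division by `C + 1` because `C` may vanish.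
  have hε : 0 < δ / (C + 1) := by positivity
  refine ⟨(δ / (C + 1)).toNNReal, ?_, ?_⟩
  · rw [Real.coe_toNNReal _ hε.le, ← mul_div_assoc, div_le_iff₀ (by positivity)]
    nlinarith
  · have h1 := (hf.tendsto t (hT ht)).mono_left (nhdsWithin_mono t hT)
    exact (h1.eventually (gt_mem_nhds (ENNReal.coe_pos.2 (Real.toNNReal_pos.2 hε)))).mono
      fun t' h => h.le

lemma IsContinuousCurve.continuousOn_prod {σ : ℝ} {T₀ : ℝ} {T : EReal} {f : ℝ → ℝ → ℝ}
    (hσ : 1 / 2 < σ) (hf : IsContinuousCurve σ T f) (hT : Icc 0 T₀ ⊆ timeIco T) :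
    ContinuousOn (fun p : ℝ × ℝ => f p.1 p.2) (Icc 0 T₀ ×ˢ univ) := by
  obtain ⟨C, hC, hsob⟩ := exists_sobolev_bound hσ
  refine continuousOn_prod_of_uniform (fun t ht => hf.representative t (hT ht))
    fun t ht δ hδ => ?_
  obtain ⟨ε, hε, hev⟩ := hf.eventually_hsNorm_le hC hT ht hδ
  filter_upwards [hev, self_mem_nhdsWithin] with t' h ht' x
  exact (hsob _ ε ((hf.representative t' (hT ht')).sub (hf.representative t (hT ht))) h x).trans hε

/-- The embedding is applied to the difference of two time slices, which turns continuity in `H^σ`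
into uniform convergence of the derivatives. -/
lemma IsContinuousCurve.continuousOn_prod_deriv {σ : ℝ} {T₀ B : ℝ} {T : EReal} {f : ℝ → ℝ → ℝ}
    (hσ : 5 / 2 < σ) (hf : IsContinuousCurve σ T f) (hT : Icc 0 T₀ ⊆ timeIco T)
    (hB : ∀ t ∈ Icc 0 T₀, BoundedC2 B (f t)) :
    ContinuousOn (fun p : ℝ × ℝ => deriv (f p.1) p.2) (Icc 0 T₀ ×ˢ univ) ∧
      ContinuousOn (fun p : ℝ × ℝ => deriv (deriv (f p.1)) p.2) (Icc 0 T₀ ×ˢ univ) := by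
  obtain ⟨C, hC, hsob⟩ := exists_sobolev_bound_C2 hσ
  have hd1 : ∀ t ∈ Icc 0 T₀, ∀ t' ∈ Icc 0 T₀,
      deriv (fun x => f t' x - f t x) = fun x => deriv (f t') x - deriv (f t) x :=
    fun t ht t' ht' => funext fun x =>
      deriv_fun_sub ((hB t' ht').differentiable x) ((hB t ht).differentiable x)
  have hd2 : ∀ t ∈ Icc 0 T₀, ∀ t' ∈ Icc 0 T₀, ∀ x,
      deriv (deriv (fun x => f t' x - f t x)) x = deriv (deriv (f t')) x - deriv (deriv (f t)) x :=
    fun t ht t' ht' x => by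
      rw [hd1 t ht t' ht']
      exact deriv_fun_sub ((hB t' ht').differentiable_deriv x) ((hB t ht).differentiable_deriv x)
  constructor
  · refine continuousOn_prod_of_uniform (h := fun t => deriv (f t))
      (fun t ht => (hB t ht).differentiable_deriv.continuous) fun t ht δ hδ => ?_
    obtain ⟨ε, hε, hev⟩ := hf.eventually_hsNorm_le hC hT ht hδ
    filter_upwards [hev, self_mem_nhdsWithin] with t' h ht' x
    have := (hsob (fun x => f t' x - f t x) ε ((hf.representative t' (hT ht')).sub
      (hf.representative t (hT ht))) h).abs_deriv_le x
    rw [hd1 t ht t' ht'] at this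
    exact this.trans hε
  · refine continuousOn_prod_of_uniform (h := fun t => deriv (deriv (f t)))
      (fun t ht => (hB t ht).continuous_deriv2) fun t ht δ hδ => ?_
    obtain ⟨ε, hε, hev⟩ := hf.eventually_hsNorm_le hC hT ht hδ
    filter_upwards [hev, self_mem_nhdsWithin] with t' h ht' x
    have := (hsob (fun x => f t' x - f t x) ε ((hf.representative t' (hT ht')).sub
      (hf.representative t (hT ht))) h).abs_deriv2_le x
    rw [hd2 t ht t' ht'] at this
    exact this.trans hε

/-- A solution in `H^{s-1} × H^s × H^s` whose norm is bounded by `M` on `[0, T₀]` is a bounded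
classical curve there. -/
lemma exists_isClassicalCurve {s : ℝ} (hs : 5 / 2 < s) (M : ℝ≥0) :
    ∃ B : ℝ, ∀ (T : EReal) (ρ₀ u₀ v₀ : ℝ → ℝ) (ρ u v : ℝ → ℝ → ℝ),
      IsSolution s T ρ₀ u₀ v₀ ρ u v → ∀ T₀ : ℝ, (T₀ : EReal) < T →
      (∀ t ∈ Icc 0 T₀, hsNorm (s - 1) (ρ t) + hsNorm s (u t) + hsNorm s (v t) ≤ (M : ℝ≥0∞)) →
      IsClassicalCurve B T₀ ρ u v := by
  obtain ⟨C, hC, hsob⟩ := exists_sobolev_bound (σ := s - 1) (by linarith)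
  obtain ⟨C', hC', hsob'⟩ := exists_sobolev_bound_C2 hs
  refine ⟨C * M + C' * M, fun T ρ₀ u₀ v₀ ρ u v hsol T₀ hT₀ hM => ?_⟩
  have hlt : ∀ t ≤ T₀, (t : EReal) < T := fun t ht =>
    (EReal.coe_le_coe_iff.2 ht).trans_lt hT₀
  have hT : Icc 0 T₀ ⊆ timeIco T := fun t ht => ⟨ht.1, hlt t ht.2⟩
  have hu : ∀ t ∈ Icc 0 T₀, BoundedC2 (C * M + C' * M) (u t) := fun t ht =>
    (hsob' _ M (hsol.regularity_u.representative t (hT ht))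
      ((le_add_self.trans le_self_add).trans (hM t ht))).mono
      (le_add_of_nonneg_left (by positivity))
  have hv : ∀ t ∈ Icc 0 T₀, BoundedC2 (C * M + C' * M) (v t) := fun t ht =>
    (hsob' _ M (hsol.regularity_v.representative t (hT ht)) (le_add_self.trans (hM t ht))).mono
      (le_add_of_nonneg_left (by positivity))
  have cu := hsol.regularity_u.continuousOn_prod (by linarith) hT
  have cv := hsol.regularity_v.continuousOn_prod (by linarith) hT
  have cu' := hsol.regularity_u.continuousOn_prod_deriv hs hT hu
  have cv' := hsol.regularity_v.continuousOn_prod_deriv hs hT hv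
  exact
    { continuousOn_rho := hsol.regularity_rho.continuousOn_prod (by linarith) hT
      continuousOn_u := cu
      continuousOn_u1 := cu'.1
      continuousOn_m := cu.sub cu'.2
      continuousOn_v := cv
      continuousOn_v1 := cv'.1
      continuousOn_n := cv.sub cv'.2
      abs_rho_le := fun t ht x =>
        (hsob _ M (hsol.regularity_rho.representative t (hT ht))
          ((le_self_add.trans le_self_add).trans (hM t ht)) x).trans
          (le_add_of_nonneg_right (by positivity))
      bounded_u := hu
      bounded_v := hv
      equation_rho := fun φ hφ hφc t ht => hsol.equation_rho φ hφ hφc t ht.1 (hlt t ht.2.le)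
      equation_m := fun φ hφ hφc t ht => hsol.equation_m φ hφ hφc t ht.1 (hlt t ht.2.le)
      equation_n := fun φ hφ hφc t ht => hsol.equation_n φ hφ hφc t ht.1 (hlt t ht.2.le) }

/-! ### Weighted supremum bounds -/

lemma abs_mul_le_of_eLpNorm_top_le {f w : ℝ → ℝ} {C : ℝ≥0} (hf : Continuous f)
    (hw : Continuous w) (hw0 : ∀ x, 0 < w x)
    (h : eLpNorm (fun x => f x * w x) ⊤ volume ≤ (C : ℝ≥0∞)) (x : ℝ) : |f x| * w x ≤ C := by
  rw [eLpNorm_exponent_top] at h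
  have hae : ∀ᵐ y ∂(volume : Measure ℝ), |f y| * w y ≤ C := by
    filter_upwards [ae_le_eLpNormEssSup (f := fun x => f x * w x) (μ := volume)] with y hy
    have h1 := hy.trans h
    rw [enorm_le_coe] at h1
    have h2 : ‖f y * w y‖ ≤ C := h1
    rwa [norm_mul, Real.norm_eq_abs, Real.norm_of_nonneg (hw0 y).le] at h2
  -- The set where the bound holds is closed, and it is dense since it has full measure; so it is
  -- the whole line.
  have hcl : IsClosed {y | |f y| * w y ≤ C} := isClosed_le (by fun_prop) continuous_const
  have hd := Measure.dense_of_ae hae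
  have := hd.closure_eq
  rw [hcl.closure_eq] at this
  exact this.symm.subset (mem_univ x)

lemma eLpNorm_top_le_of_abs_mul_le {f w : ℝ → ℝ} {C : ℝ} (hw0 : ∀ x, 0 < w x)
    (h : ∀ x, |f x| * w x ≤ C) :
    eLpNorm (fun x => f x * w x) ⊤ volume ≤ (C.toNNReal : ℝ≥0∞) := by
  rw [eLpNorm_exponent_top]
  refine eLpNormEssSup_le_of_ae_bound (Eventually.of_forall fun x => ?_)
  rw [norm_mul, Real.norm_eq_abs, Real.norm_of_nonneg (hw0 x).le]
  exact h x

namespace IsClassicalCurve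

variable {B T₀ : ℝ} {ρ u v : ℝ → ℝ → ℝ}

/-- Persistence of the decay of the density and of both momenta. -/
lemma density_mul_sq_weight_le (h : IsClassicalCurve B T₀ ρ u v) {w : ℝ → ℝ} {C D L : ℝ}
    (hw : ∀ x, 0 < w x) (hmod : ∀ x y, w x ≤ D * Real.exp (|x - y| / 2) * w y) (hD : 0 < D)
    (hL : T₀ ≤ L) (hρ₀ : ∀ x, |ρ 0 x| * w x ≤ C) (hm₀ : ∀ x, |momentum (u 0) x| * w x ≤ 2 * C)
    (hn₀ : ∀ x, |momentum (v 0) x| * w x ≤ 2 * C) {t : ℝ} (ht : t ∈ Icc 0 T₀) (x : ℝ) :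
    density (ρ t) (u t) (v t) x * w x ^ 2 ≤
      (3 * C * D * Real.exp (4 * B ^ 2 * L)) ^ 2 := by
  obtain ⟨y, hy, hle⟩ := h.exists_density_le ht x
  have hT₀ : 0 ≤ T₀ := ht.1.trans ht.2
  have hwy : w x ≤ D * Real.exp (B ^ 2 * L / 2) * w y := by
    refine (hmod x y).trans ?_
    have := (hw y).le
    have : |x - y| ≤ B ^ 2 * L := hy.trans (by gcongr)
    gcongr
  have hsq : ∀ {a c : ℝ}, |a| * w y ≤ c → a ^ 2 * w y ^ 2 ≤ c ^ 2 := fun {a c} hac => by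
    rw [← sq_abs a, ← mul_pow]
    have := mul_nonneg (abs_nonneg a) (hw y).le
    gcongr
  -- The constant is `1 + 4 + 4`, since each momentum is bounded by `2 * C`.
  have h0 : density (ρ 0) (u 0) (v 0) y * w y ^ 2 ≤ 9 * C ^ 2 := by
    rw [density]
    linarith [hsq (hρ₀ y), hsq (hm₀ y), hsq (hn₀ y)]
  have hden : 0 ≤ density (ρ 0) (u 0) (v 0) y := by rw [density]; positivity
  have hwx := (hw x).le
  calc density (ρ t) (u t) (v t) x * w x ^ 2
      ≤ (Real.exp (7 * B ^ 2 * L) * density (ρ 0) (u 0) (v 0) y) *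
          (D * Real.exp (B ^ 2 * L / 2) * w y) ^ 2 := by
        gcongr
        refine hle.trans ?_
        have : t ≤ L := ht.2.trans hL
        gcongr
    _ = D ^ 2 * (Real.exp (7 * B ^ 2 * L) * Real.exp (B ^ 2 * L / 2) ^ 2) *
          (density (ρ 0) (u 0) (v 0) y * w y ^ 2) := by ring
    _ ≤ D ^ 2 * (Real.exp (7 * B ^ 2 * L) * Real.exp (B ^ 2 * L / 2) ^ 2) * (9 * C ^ 2) := by
        gcongr
    _ = _ := by
        -- Gronwall contributes `7 * B ^ 2 * L` to the exponent and the squared weight shift another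
        -- `B ^ 2 * L`.
        have : Real.exp (7 * B ^ 2 * L) * Real.exp (B ^ 2 * L / 2) ^ 2 =
            Real.exp (4 * B ^ 2 * L) ^ 2 := by
          rw [← Real.exp_nat_mul, ← Real.exp_nat_mul, ← Real.exp_add]
          congr 1
          push_cast
          ring
        rw [this]
        ring

end IsClassicalCurve

lemma WeightedBound.mul_weight_le {β : ℝ} (hβ : 0 < β) {C : ℝ≥0} {K : ℝ} {ρ u v : ℝ → ℝ}
    (h : WeightedBound β C ρ u v) (hρ : Continuous ρ) (hu : BoundedC2 K u) (hv : BoundedC2 K v)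
    (x : ℝ) : |ρ x| * logWeight β x ≤ C ∧ |momentum u x| * logWeight β x ≤ 2 * C ∧
      |momentum v x| * logWeight β x ≤ 2 * C := by
  have hp := fun {f : ℝ → ℝ} (hf : Continuous f)
      (hm : f ∈ ([ρ, u, deriv u, deriv (deriv u), v, deriv v, deriv (deriv v)] : List (ℝ → ℝ))) =>
    abs_mul_le_of_eLpNorm_top_le hf (continuous_logWeight hβ) (logWeight_pos hβ) (h f hm) x
  have hmom : ∀ {f : ℝ → ℝ}, |f x| * logWeight β x ≤ C →
      |deriv (deriv f) x| * logWeight β x ≤ C → |momentum f x| * logWeight β x ≤ 2 * C :=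
    fun {f} h1 h2 => by
      have h3 : |momentum f x| ≤ |f x| + |deriv (deriv f) x| := abs_sub _ _
      nlinarith [mul_le_mul_of_nonneg_right h3 (logWeight_pos hβ x).le]
  exact ⟨hp hρ (by simp), hmom (hp hu.differentiable.continuous (by simp))
    (hp hu.continuous_deriv2 (by simp)), hmom (hp hv.differentiable.continuous (by simp))
    (hp hv.continuous_deriv2 (by simp))⟩


end ThreeDP

end

open ThreeDP in
theorem theorem1p5 (s : ℝ) (hs : 5 / 2 < s) (β : ℝ) (hβ : 0 < β) (C₀ M : ℝ≥0) (L : ℝ) :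
    ∃ C₁ : ℝ≥0, ∀ (T : EReal) (ρ₀ u₀ v₀ : ℝ → ℝ) (ρ u v : ℝ → ℝ → ℝ), 0 < T →
      IsSolution s T ρ₀ u₀ v₀ ρ u v →
      WeightedBound β C₀ ρ₀ u₀ v₀ →
      ∀ T₀ : ℝ, 0 ≤ T₀ → T₀ ≤ L → (T₀ : EReal) < T →
        (∀ t ∈ Icc 0 T₀, hsNorm (s - 1) (ρ t) + hsNorm s (u t) + hsNorm s (v t) ≤ (M : ℝ≥0∞)) →
        ∀ t ∈ Icc 0 T₀, WeightedBound β C₁ (ρ t) (u t) (v t) := by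
  obtain ⟨B, hB⟩ := exists_isClassicalCurve hs M
  obtain ⟨D, hD, hmod⟩ := exists_logWeight_le hβ
  have hw := logWeight_pos hβ
  set A : ℝ := 3 * C₀ * D * Real.exp (4 * B ^ 2 * L) with hAdef
  have hA : 0 ≤ A := by positivity
  -- The bound for the second derivatives, the largest of those obtained. Neither `A` nor `D`
  -- involves the solution, `T` or `T₀`.
  refine ⟨(A + 2 * A * D).toNNReal, fun T ρ₀ u₀ v₀ ρ u v _ hsol hinit T₀ hT₀ hL hT hM t ht => ?_⟩
  have hc := hB T ρ₀ u₀ v₀ ρ u v hsol T₀ hT hM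
  have h0 : (0 : ℝ) ∈ Icc 0 T₀ := ⟨le_rfl, hT₀⟩
  have hρ₀ : Continuous (ρ 0) := hsol.regularity_rho.representative 0
    ⟨le_rfl, (EReal.coe_le_coe_iff.2 hT₀).trans_lt hT⟩
  rw [← hsol.initial_rho, ← hsol.initial_u, ← hsol.initial_v] at hinit
  have hi := hinit.mul_weight_le hβ hρ₀ (hc.bounded_u 0 h0) (hc.bounded_v 0 h0)
  have hden := hc.density_mul_sq_weight_le hw hmod hD hL (fun x => (hi x).1)
    (fun x => (hi x).2.1) (fun x => (hi x).2.2) ht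
  -- Each of `ρ²`, `m²`, `n²` is at most the density, so a square root recovers the linear weighted
  -- bounds.
  have hroot : ∀ (a : ℝ) (x : ℝ), a ^ 2 ≤ IsClassicalCurve.density (ρ t) (u t) (v t) x →
      |a| * logWeight β x ≤ A := fun a x hax => by
    refine abs_le_of_sq_le_sq' ?_ hA |>.2
    rw [mul_pow, sq_abs]
    exact (mul_le_mul_of_nonneg_right hax (sq_nonneg _)).trans (hden x)
  have hρ : ∀ x, |ρ t x| * logWeight β x ≤ A := fun x => hroot _ x (by
    rw [IsClassicalCurve.density]
    nlinarith [sq_nonneg (momentum (u t) x), sq_nonneg (momentum (v t) x)])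
  have hm : ∀ x, |momentum (u t) x| * logWeight β x ≤ A := fun x => hroot _ x (by
    rw [IsClassicalCurve.density]; nlinarith [sq_nonneg (ρ t x), sq_nonneg (momentum (v t) x)])
  have hn : ∀ x, |momentum (v t) x| * logWeight β x ≤ A := fun x => hroot _ x (by
    rw [IsClassicalCurve.density]; nlinarith [sq_nonneg (ρ t x), sq_nonneg (momentum (u t) x)])
  have hu := (hc.bounded_u t ht).weighted_bounds hw hmod hD hA hm
  have hv := (hc.bounded_v t ht).weighted_bounds hw hmod hD hA hn
  have hAD : 0 ≤ 2 * A * D := by positivity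
  intro f hf
  refine eLpNorm_top_le_of_abs_mul_le hw fun x => ?_
  simp only [List.mem_cons, List.not_mem_nil, or_false] at hf
  rcases hf with rfl | rfl | rfl | rfl | rfl | rfl | rfl
  · linarith [hρ x]
  · linarith [(hu x).1]
  · linarith [(hu x).2.1]
  · exact (hu x).2.2
  · linarith [(hv x).1]
  · linarith [(hv x).2.1]
  · exact (hv x).2.2
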